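/- Let $dA=\pi^{-1}\,dx\,dy$ on $\mathbb C$, $\partial=\frac12(\partial_x-i\partial_y)$, $\bar\partial=\frac12(\partial_x+i\partial_y)$, $\Delta=\partial\bar\partial$, and $\mathbb D(a,\rho)=\{z:|z-a|<\rho\}$. A function on an open set is called bianalytic if it is continuous and satisfies $\bar\partial^2 f=0$ in the sense of distributions. Let $Q:\mathbb C\to\mathbb R$ be continuous, $z_0\in\mathbb C$, and let $r>0$ be such that, with $D=\mathbb D(z_0,r)$: 1. $Q$ is real-analytic in $D$, and $\Delta Q>\epsilon$ on $D$ for some $\epsilon>0$; 2. there is a polarization of $Q$ in $D$, i.e. a function $(z,w)\mapsto Q(z,w)$ on $D\times D$ that is analytic in $z$, anti-analytic in $w$, and satisfies $Q(z,z)=Q(z)$; 3. for all $z,w\in D$ we have $b(z,w):=\partial_z\bar\partial_wQ(z,w)\ne0$ and $\bar\partial_w\theta(z,w)\neq 0$, where $\theta(z,w)=\frac{Q(w)-Q(z,w)}{w-z}$ for $z\neq w$ and $\theta(w,w)=\partial_zQ(z,w)|_{z=w}$; 4. $2\,\mathrm{Re}\,Q(z,w)-Q(w)-Q(z)\le-\frac12\Delta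 Q(z_0)|w-z|^2$ for all $z,w\in D$. Fix a smooth function $\chi_0:\mathbb R\to[0,\infty)$ that equals $1$ on $(-\frac23,\frac23)$ and has its support in $(-1,1)$, and put $\chi(w)=\chi_0(|w-z_0|/r)$. For $m\ge1$ and $z,w\in D$ let $$K^{(2)}_{2,m}(z,w)=\Big\{-m^2|z-w|^2b^2+m\Big[2b+(z-w)\partial_zb-(\bar z-\bar w)\bar\partial_wb+|z-w|^2\Big(-\tfrac32\bar\partial_w\partial_zb+\frac{\partial_zb\cdot\bar\partial_wb}{b}\Big)\Big]\Big\}e^{mQ(z,w)}.$$ Then $K^{(2)}_{2,m}$ is a local bianalytic Bergman kernel $\mathrm{mod}(m^{-1/2})$; that is: (a) for every $m\ge1$, $K^{(2)}_{2,m}(z,w)$ is bianalytic in $z\in D$ for each fixed $w\in D$, and, for each fixed $z\in D$, it is real-analytic in $w\in D$ and satisfies $\partial_w^2K^{(2)}_{2,m}(z,w)=0$; (b) there is a constant $C$ such that for all real $m\ge1$, all bianalytic $u:\mathbb C\to\mathbb C$ with $\|u\|_m^2:=\int_{\mathbb C}|u|^2e^{-mQ}\,dA<\infty$, and all $z\in\mathbb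 D(z_0,\frac13r)$, $$\Big|u(z)-\int_{D}u(w)\chi(w)K^{(2)}_{2,m}(z,w)e^{-mQ(w)}\,dA(w)\Big|\le C\,\|u\|_m\,e^{\frac12mQ(z)}\,m^{-1/2}.$$ -/

import Mathlib

noncomputable section

namespace LocalBergman

/-- The Wirtinger derivative `∂ = (∂_x - i ∂_y) / 2`. -/
def wirt (f : ℂ → ℂ) (z : ℂ) : ℂ :=
  (fderiv ℝ f z 1 - Complex.I * fderiv ℝ f z Complex.I) / 2

/-- The Wirtinger derivative `∂̄ = (∂_x + i ∂_y) / 2`. -/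
def wirtBar (f : ℂ → ℂ) (z : ℂ) : ℂ :=
  (fderiv ℝ f z 1 + Complex.I * fderiv ℝ f z Complex.I) / 2

/-- `ΔQ = ∂ ∂̄ Q`, a quarter of the usual Laplacian. -/
def lapl (Q : ℂ → ℝ) (z : ℂ) : ℝ :=
  (wirt (wirtBar fun ζ => (Q ζ : ℂ)) z).re

/-- The normalized area measure `dA = π⁻¹ dx dy`. -/
def areaMeasure : MeasureTheory.Measure ℂ :=
  ENNReal.ofReal Real.pi⁻¹ • MeasureTheory.volume

/-- Complex-valued test functions with compact support in `U`. -/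
structure IsTest (U : Set ℂ) (φ : ℂ → ℂ) : Prop where
  smooth : ContDiff ℝ ((⊤ : ℕ∞) : WithTop ℕ∞) φ
  compact : HasCompactSupport φ
  supp : tsupport φ ⊆ U

/-- `f` is `q`-analytic on `U`: continuous, with `∂̄^q f = 0` in the sense of distributions. -/
def IsPolyanalyticOn (q : ℕ) (f : ℂ → ℂ) (U : Set ℂ) : Prop :=
  ContinuousOn f U ∧
    ∀ φ : ℂ → ℂ, IsTest U φ → ∫ w, f w * (wirtBar^[q] φ) w ∂areaMeasure = 0

/-- `f` is `q`-analytic in the conjugate variable on `U`: continuous, with `∂^q f = 0` in the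
sense of distributions. -/
def IsConjPolyanalyticOn (q : ℕ) (f : ℂ → ℂ) (U : Set ℂ) : Prop :=
  ContinuousOn f U ∧
    ∀ φ : ℂ → ℂ, IsTest U φ → ∫ w, f w * (wirt^[q] φ) w ∂areaMeasure = 0

/-- The space `A²_{q,mQ}` of `q`-analytic functions on `ℂ` that belong to `L²(e^{-mQ} dA)`. -/
def bergmanSpace (q : ℕ) (m : ℝ) (Q : ℂ → ℝ) : Set (ℂ → ℂ) :=
  {u | IsPolyanalyticOn q u Set.univ ∧
    MeasureTheory.Integrable (fun w => ‖u w‖ ^ 2 * Real.exp (-(m * Q w))) areaMeasure}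

/-- The norm of `L²(e^{-mQ} dA)`. -/
def weightedNorm (m : ℝ) (Q : ℂ → ℝ) (u : ℂ → ℂ) : ℝ :=
  Real.sqrt (∫ w, ‖u w‖ ^ 2 * Real.exp (-(m * Q w)) ∂areaMeasure)

/-- `P` is a polarization of `Q` on the disk `𝔻(z₀, r)`: analytic in the first variable,
anti-analytic in the second one, and equal to `Q` on the diagonal. -/
structure IsPolarization (Q : ℂ → ℝ) (P : ℂ → ℂ → ℂ) (z₀ : ℂ) (r : ℝ) : Prop where
  analytic_fst : ∀ w ∈ Metric.ball z₀ r,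
    AnalyticOnNhd ℂ (fun z => P z w) (Metric.ball z₀ r)
  antianalytic_snd : ∀ z ∈ Metric.ball z₀ r,
    AnalyticOnNhd ℂ (fun w => starRingEnd ℂ (P z w)) (Metric.ball z₀ r)
  diag : ∀ z ∈ Metric.ball z₀ r, P z z = (Q z : ℂ)

/-- `b(z, w) = ∂_z ∂̄_w P(z, w)`. -/
def bfun (P : ℂ → ℂ → ℂ) (z w : ℂ) : ℂ :=
  wirt (fun ζ => wirtBar (fun ω => P ζ ω) w) z

/-- The phase function `θ(z, w) = (Q(w) - P(z, w)) / (w - z)`, continued to the diagonal by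
`θ(w, w) = (∂_z P)(w, w)`. -/
def phase (Q : ℂ → ℝ) (P : ℂ → ℂ → ℂ) (z w : ℂ) : ℂ :=
  open Classical in
  if z = w then wirt (fun ζ => P ζ w) w else ((Q w : ℂ) - P z w) / (w - z)

/-- The requirements on the radius `r` of the disk around `z₀`. -/
structure IsAdmissible (Q : ℂ → ℝ) (P : ℂ → ℂ → ℂ) (z₀ : ℂ) (r : ℝ) : Prop where
  radius_pos : 0 < r
  analytic : AnalyticOnNhd ℝ Q (Metric.ball z₀ r)
  lapl_bound : ∃ ε : ℝ, 0 < ε ∧ ∀ z ∈ Metric.ball z₀ r, ε < lapl Q z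
  polarization : IsPolarization Q P z₀ r
  bfun_ne : ∀ z ∈ Metric.ball z₀ r, ∀ w ∈ Metric.ball z₀ r, bfun P z w ≠ 0
  phase_ne : ∀ z ∈ Metric.ball z₀ r, ∀ w ∈ Metric.ball z₀ r,
    wirtBar (fun ω => phase Q P z ω) w ≠ 0
  decay : ∀ z ∈ Metric.ball z₀ r, ∀ w ∈ Metric.ball z₀ r,
    2 * (P z w).re - Q w - Q z ≤ -(1 / 2) * lapl Q z₀ * ‖w - z‖ ^ 2

/-- The profile of the cut-off function: smooth, non-negative, equal to `1` on `(-2/3, 2/3)`, with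
support in `(-1, 1)`. -/
structure IsCutoffProfile (χ₀ : ℝ → ℝ) : Prop where
  smooth : ContDiff ℝ ((⊤ : ℕ∞) : WithTop ℕ∞) χ₀
  nonneg : ∀ t, 0 ≤ χ₀ t
  eq_one : ∀ t ∈ Set.Ioo (-(2 / 3) : ℝ) (2 / 3), χ₀ t = 1
  supp : tsupport χ₀ ⊆ Set.Ioo (-1) 1

/-- The cut-off function `χ(w) = χ₀(|w - z₀| / r)`. -/
def cutoff (χ₀ : ℝ → ℝ) (z₀ : ℂ) (r : ℝ) (w : ℂ) : ℝ := χ₀ (‖w - z₀‖ / r)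

/-- The family `L m` is a local `q`-analytic reproducing kernel modulo `err m` on `𝔻(z₀, r)`.
The constant `C` does not depend on `m`, `u` and `z`. -/
structure IsLocalReproducingKernel (q : ℕ) (Q : ℂ → ℝ) (z₀ : ℂ) (r : ℝ) (χ₀ : ℝ → ℝ)
    (err : ℝ → ℝ) (L : ℝ → ℂ → ℂ → ℂ) : Prop where
  polyanalytic_fst : ∀ m : ℝ, 1 ≤ m → ∀ w ∈ Metric.ball z₀ r,
    IsPolyanalyticOn q (fun z => L m z w) (Metric.ball z₀ r)
  analytic_snd : ∀ m : ℝ, 1 ≤ m → ∀ z ∈ Metric.ball z₀ r,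
    AnalyticOnNhd ℝ (fun w => L m z w) (Metric.ball z₀ r)
  reproducing : ∃ C : ℝ, ∀ m : ℝ, 1 ≤ m → ∀ u ∈ bergmanSpace q m Q,
    ∀ z ∈ Metric.ball z₀ (r / 3),
      ‖u z - ∫ w in Metric.ball z₀ r,
          u w * (cutoff χ₀ z₀ r w : ℂ) * L m z w * (Real.exp (-(m * Q w)) : ℂ) ∂areaMeasure‖
        ≤ C * (weightedNorm m Q u * Real.exp (m * Q z / 2) * err m)

/-- A local `q`-analytic Bergman kernel modulo `err m`: a local `q`-analytic reproducing kernel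
that is `q`-analytic in the conjugate of the second variable. -/
structure IsLocalBergmanKernel (q : ℕ) (Q : ℂ → ℝ) (z₀ : ℂ) (r : ℝ) (χ₀ : ℝ → ℝ)
    (err : ℝ → ℝ) (L : ℝ → ℂ → ℂ → ℂ) : Prop
    extends IsLocalReproducingKernel q Q z₀ r χ₀ err L where
  conjPolyanalytic_snd : ∀ m : ℝ, 1 ≤ m → ∀ z ∈ Metric.ball z₀ r,
    IsConjPolyanalyticOn q (fun w => L m z w) (Metric.ball z₀ r)

/-- The coefficient `-|z-w|² b²` of `m²`. -/
def coeff0 (P : ℂ → ℂ → ℂ) (z w : ℂ) : ℂ :=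
  -((‖z - w‖ : ℂ) ^ 2) * bfun P z w ^ 2

/-- The coefficient
`2b + (z-w) ∂_z b - (z̄-w̄) ∂̄_w b + |z-w|² (-(3/2) ∂̄_w ∂_z b + ∂_z b · ∂̄_w b / b)` of `m`. -/
def coeff1 (P : ℂ → ℂ → ℂ) (z w : ℂ) : ℂ :=
  2 * bfun P z w
    + (z - w) * wirt (fun ζ => bfun P ζ w) z
    - (starRingEnd ℂ z - starRingEnd ℂ w) * wirtBar (fun ω => bfun P z ω) w
    + (‖z - w‖ : ℂ) ^ 2 *
      (-(3 / 2) * wirtBar (fun ω => wirt (fun ζ => bfun P ζ ω) z) w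
        + wirt (fun ζ => bfun P ζ w) z * wirtBar (fun ω => bfun P z ω) w / bfun P z w)

/-- The two-term kernel `(m² coeff0 + m coeff1) e^{m P(z, w)}`. -/
def twoTermKernel (P : ℂ → ℂ → ℂ) (m : ℝ) (z w : ℂ) : ℂ :=
  ((m : ℂ) ^ 2 * coeff0 P z w + (m : ℂ) * coeff1 P z w) * Complex.exp ((m : ℂ) * P z w)

end LocalBergman

end

noncomputable section

open Metric Filter Topology Set ComplexConjugate MeasureTheory

namespace LocalBergman

/-! The reproducing property is a Cauchy-Pompeiu formula applied to a well-chosen test function. For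
smooth compactly supported `G` with `G(z) = 1` and `∂̄G(z) = 0`, every bianalytic `u` satisfies
`u(z) = -∫ u [2 ∂̄G/(w-z) + (w̄-z̄)/(w-z) ∂̄²G] dA` (`bianalytic_representation`). Take `G(w) = χ(w)
(1 - c(w-z)) e^{m(P(z,w)-Q(w))}` with `c = ∂_z b/b` at `(z,z)`. Since `∂̄_w(P(z,w)-Q(w))` vanishes
at `w = z`, this `G` is admissible, and differentiating it produces an exact reproducing amplitude
`phaseAmp`, plus a term `cutoffAmp` carrying the derivatives of `χ`.

Put `ζ = w-z` and expand `∂̄_w(Q(w)-P(z,w)) = ζb + ζ²∂_z b/2 + O(ζ³)`. Without the factor `1 - cζ`,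
the exact amplitude would differ from that of the stated kernel by terms of size `m|ζ|` and
`m²|ζ|³`, which are too large by a factor `m^{1/2}`. The choice of `c` cancels both at once
(`amplitude_identity`), and the difference is `O(m|ζ|² + m²|ζ|⁴)` (`IsAdmissible.amplitude_bound`).
The coefficient of `|z-w|²` in the `m`-term lies within this error, so only its boundedness matters
here.

The derivatives of `χ` live at distance at least `r/3` from `z`, so `cutoffAmp` obeys a bound of the
same kind. The decay hypothesis on `2 Re P - Q - Q` supplies a Gaussian in `m^{1/2}|ζ|`; half of it
absorbs the polynomial amplitude, and Cauchy-Schwarz against the other half gives the factor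
`m^{-1/2}`.

The expansions need `P` to be jointly regular, while analyticity is assumed only separately. The
decay hypothesis bounds `Re P` from above, Borel-Carathéodory turns this into a local bound on
`|P|`, and joint continuity follows (`IsAdmissible.sepHol`). Bianalyticity of the kernel is read off
from its degree one in `z̄-w̄` and in `w-z`. -/

/-- `F` is holomorphic in each variable on `U × V`, and jointly continuous there. -/
structure SepHol (F : ℂ → ℂ → ℂ) (U V : Set ℂ) : Prop where
  fst : ∀ v ∈ V, DifferentiableOn ℂ (fun z => F z v) U
  snd : ∀ z ∈ U, DifferentiableOn ℂ (F z) V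
  cont : ContinuousOn (fun x : ℂ × ℂ => F x.1 x.2) (U ×ˢ V)

/-- The partial derivative in the first variable. -/
def D1 (F : ℂ → ℂ → ℂ) (z v : ℂ) : ℂ := deriv (fun ζ => F ζ v) z

/-- The partial derivative in the second variable. -/
def D2 (F : ℂ → ℂ → ℂ) (z v : ℂ) : ℂ := deriv (F z) v

/-! ### Joint regularity of separately holomorphic functions -/

lemma dist_le_of_norm_le_on_ball {f : ℂ → ℂ} {c z : ℂ} {R M : ℝ}
    (hf : DifferentiableOn ℂ f (ball c R)) (hM : ∀ x ∈ ball c R, ‖f x‖ ≤ M) (hz : z ∈ ball c R) :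
    dist (f z) (f c) ≤ 2 * M / R * dist z c := by
  refine Complex.dist_le_div_mul_dist_of_mapsTo_ball hf (fun x hx => ?_) hz
  have hR : 0 < R := pos_of_mem_ball hz
  rw [mem_closedBall, dist_eq_norm]
  linarith [norm_sub_le (f x) (f c), hM x hx, hM c (mem_ball_self hR)]

/-- Separately holomorphic functions that are locally bounded are jointly continuous. -/
lemma SepHol.of_locally_bounded {F : ℂ → ℂ → ℂ} {U V : Set ℂ} (hU : IsOpen U) (hV : IsOpen V)
    (h1 : ∀ v ∈ V, DifferentiableOn ℂ (fun z => F z v) U)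
    (h2 : ∀ z ∈ U, DifferentiableOn ℂ (F z) V)
    (hb : ∀ z ∈ U, ∀ v ∈ V, ∃ M, ∀ᶠ x in 𝓝 (z, v), ‖F x.1 x.2‖ ≤ M) : SepHol F U V := by
  refine ⟨h1, h2, ?_⟩
  rintro ⟨z, v⟩ ⟨hz, hv⟩
  apply ContinuousAt.continuousWithinAt
  obtain ⟨M, hM⟩ := hb z hz v hv
  obtain ⟨ε, hε, hM⟩ := Metric.eventually_nhds_iff_ball.1
    (hM.and ((hU.prod hV).mem_nhds (⟨hz, hv⟩ : (z, v) ∈ U ×ˢ V)))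
  have hM' : ∀ s ∈ ball z ε, ∀ t ∈ ball v ε, ‖F s t‖ ≤ M ∧ s ∈ U ∧ t ∈ V := by
    intro s hs t ht
    exact hM (s, t) (by rw [← ball_prod_same]; exact ⟨hs, ht⟩)
  have hz1 : ContinuousAt (fun x : ℂ × ℂ => F x.1 v) (z, v) :=
    ContinuousAt.comp (f := fun x : ℂ × ℂ => x.1) (g := fun s => F s v)
      ((h1 v hv).differentiableAt (hU.mem_nhds hz)).continuousAt continuousAt_fst
  -- The Schwarz lemma in the second variable gives a Lipschitz constant that is uniform in the
  -- first variable, because the bound `M` is.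
  have hdiff : Tendsto (fun x : ℂ × ℂ => F x.1 x.2 - F x.1 v) (𝓝 (z, v)) (𝓝 0) := by
    apply squeeze_zero_norm' (a := fun x : ℂ × ℂ => 2 * M / ε * dist x.2 v)
    · filter_upwards [prod_mem_nhds (ball_mem_nhds z hε) (ball_mem_nhds v hε)] with x hx
      rw [← dist_eq_norm]
      exact dist_le_of_norm_le_on_ball
        ((h2 x.1 (hM' _ hx.1 v (mem_ball_self hε)).2.1).mono fun t ht => (hM' _ hx.1 t ht).2.2)
        (fun t ht => (hM' _ hx.1 t ht).1) hx.2
    · have : Continuous fun x : ℂ × ℂ => 2 * M / ε * dist x.2 v := by fun_prop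
      simpa using this.tendsto (z, v)
  have := hdiff.add hz1
  simpa [ContinuousAt] using this

lemma SepHol.swap {F : ℂ → ℂ → ℂ} {U V : Set ℂ} (h : SepHol F U V) :
    SepHol (fun v z => F z v) V U :=
  ⟨h.snd, h.fst, h.cont.comp continuous_swap.continuousOn fun _ hx => ⟨hx.2, hx.1⟩⟩

lemma SepHol.continuousAt {F : ℂ → ℂ → ℂ} {U V : Set ℂ} (hU : IsOpen U) (hV : IsOpen V)
    (h : SepHol F U V) {z v : ℂ} (hz : z ∈ U) (hv : v ∈ V) :
    ContinuousAt (fun x : ℂ × ℂ => F x.1 x.2) (z, v) :=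
  h.cont.continuousAt ((hU.prod hV).mem_nhds ⟨hz, hv⟩)

/-- Cauchy's estimate for `s ↦ F s x.2 - F s v` on a circle of radius `ε/4`: by the Schwarz lemma
this difference is `O(|x.2 - v|)` uniformly on the circle. -/
lemma SepHol.continuousAt_D1 {F : ℂ → ℂ → ℂ} {U V : Set ℂ} (hU : IsOpen U) (hV : IsOpen V)
    (h : SepHol F U V) {z v : ℂ} (hz : z ∈ U) (hv : v ∈ V) :
    ContinuousAt (fun x : ℂ × ℂ => D1 F x.1 x.2) (z, v) := by
  have hc := (h.continuousAt hU hV hz hv).norm.eventually_lt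
    (continuousAt_const (y := ‖F z v‖ + 1)) (by simp)
  obtain ⟨ε, hε, hM⟩ := Metric.eventually_nhds_iff_ball.1
    (hc.and ((hU.prod hV).mem_nhds (⟨hz, hv⟩ : (z, v) ∈ U ×ˢ V)))
  set M := ‖F z v‖ + 1
  have hM' : ∀ s ∈ ball z ε, ∀ t ∈ ball v ε, ‖F s t‖ ≤ M ∧ s ∈ U ∧ t ∈ V := by
    intro s hs t ht
    obtain ⟨a, b, c⟩ := hM (s, t) (by rw [← ball_prod_same]; exact ⟨hs, ht⟩)
    exact ⟨a.le, b, c⟩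
  have hz1 : ContinuousAt (fun x : ℂ × ℂ => D1 F x.1 v) (z, v) :=
    ContinuousAt.comp (f := fun x : ℂ × ℂ => x.1) (g := fun s => D1 F s v)
      ((((h.fst v hv).deriv hU).differentiableAt (hU.mem_nhds hz)).continuousAt) continuousAt_fst
  have hdiff : Tendsto (fun x : ℂ × ℂ => D1 F x.1 x.2 - D1 F x.1 v) (𝓝 (z, v)) (𝓝 0) := by
    apply squeeze_zero_norm' (a := fun x : ℂ × ℂ => 2 * M / ε * dist x.2 v / (ε / 4))
    · filter_upwards [prod_mem_nhds (ball_mem_nhds z (half_pos hε)) (ball_mem_nhds v hε)] with x hx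
      have hsub : closedBall x.1 (ε / 4) ⊆ ball z ε := by
        intro s hs
        rw [mem_closedBall] at hs
        have := hx.1
        rw [mem_ball] at this ⊢
        linarith [dist_triangle s x.1 z]
      have hv' : v ∈ ball v ε := mem_ball_self hε
      have hd : ∀ t ∈ ball v ε, ∀ s ∈ ball z ε, DifferentiableAt ℂ (fun s => F s t) s :=
        fun t ht s hs =>
          (h.fst t (hM' s hs t ht).2.2).differentiableAt (hU.mem_nhds (hM' s hs t ht).2.1)
      have hx1 : x.1 ∈ ball z ε := hsub (mem_closedBall_self (by positivity))
      have e : D1 F x.1 x.2 - D1 F x.1 v = deriv (fun s => F s x.2 - F s v) x.1 :=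
        (deriv_fun_sub (hd _ hx.2 _ hx1) (hd _ hv' _ hx1)).symm
      rw [e]
      refine Complex.norm_deriv_le_of_forall_mem_sphere_norm_le (by positivity) ?_ ?_
      · refine DifferentiableOn.diffContOnCl fun s hs => ?_
        have hs' := hsub (closure_ball_subset_closedBall hs)
        exact ((hd _ hx.2 _ hs').sub (hd _ hv' _ hs')).differentiableWithinAt
      · intro s hs
        have hs' := hsub (sphere_subset_closedBall hs)
        rw [← dist_eq_norm]
        exact dist_le_of_norm_le_on_ball
          ((h.snd s (hM' _ hs' v hv').2.1).mono fun t ht => (hM' _ hs' t ht).2.2)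
          (fun t ht => (hM' _ hs' t ht).1) hx.2
    · have : Continuous fun x : ℂ × ℂ => 2 * M / ε * dist x.2 v / (ε / 4) := by fun_prop
      simpa using this.tendsto (z, v)
  have := hdiff.add hz1
  simpa [ContinuousAt] using this

/-- The mean value inequality for `s ↦ F s y - s * D1 F z y`, with `D1 F` jointly continuous. Local
uniformity is the point: Weierstrass' theorem then makes `D1 F` holomorphic in the second variable
and allows the limit to be differentiated, which is how the mixed partials are seen to agree. -/
lemma SepHol.differenceQuotient_tendsto {F : ℂ → ℂ → ℂ} {U V : Set ℂ} (hU : IsOpen U)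
    (hV : IsOpen V) (h : SepHol F U V) {z : ℂ} (hz : z ∈ U) :
    TendstoLocallyUniformlyOn (fun t v => t⁻¹ * (F (z + t) v - F z v)) (D1 F z) (𝓝[≠] 0) V := by
  rw [Metric.tendstoLocallyUniformlyOn_iff]
  intro ε hε v hv
  have hc := h.continuousAt_D1 hU hV hz hv
  have hev := (Metric.tendsto_nhds.1 hc (ε / 4) (by positivity)).and
    ((hU.prod hV).mem_nhds (⟨hz, hv⟩ : (z, v) ∈ U ×ˢ V))
  obtain ⟨δ, hδ, hM⟩ := Metric.eventually_nhds_iff_ball.1 hev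
  have hM' : ∀ s ∈ ball z δ, ∀ t ∈ ball v δ,
      dist (D1 F s t) (D1 F z v) < ε / 4 ∧ s ∈ U ∧ t ∈ V := by
    intro s hs t ht
    exact hM (s, t) (by rw [← ball_prod_same]; exact ⟨hs, ht⟩)
  refine ⟨ball v δ, mem_nhdsWithin_of_mem_nhds (ball_mem_nhds v hδ), ?_⟩
  filter_upwards [self_mem_nhdsWithin,
    mem_nhdsWithin_of_mem_nhds (ball_mem_nhds (0 : ℂ) hδ)] with t ht0 ht y hy
  have ht0' : t ≠ 0 := ht0
  have hzt : z + t ∈ ball z δ := by simpa using ht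
  have hzz : z ∈ ball z δ := mem_ball_self hδ
  have key : ‖(F (z + t) y - (z + t) * D1 F z y) - (F z y - z * D1 F z y)‖
      ≤ ε / 2 * ‖(z + t) - z‖ := by
    refine Convex.norm_image_sub_le_of_norm_hasDerivWithin_le
      (f := fun s => F s y - s * D1 F z y) (f' := fun s => D1 F s y - 1 * D1 F z y)
      (s := ball z δ) (fun s hs => ?_) (fun s hs => ?_) (convex_ball _ _) hzz hzt
    · apply HasDerivAt.hasDerivWithinAt
      exact (((h.fst y (hM' s hs y hy).2.2).differentiableAt
        (hU.mem_nhds (hM' s hs y hy).2.1)).hasDerivAt).sub ((hasDerivAt_id s).mul_const _)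
    · rw [one_mul, ← dist_eq_norm]
      linarith [dist_triangle_right (D1 F s y) (D1 F z y) (D1 F z v), (hM' s hs y hy).1,
        (hM' z hzz y hy).1]
  have e : (F (z + t) y - (z + t) * D1 F z y) - (F z y - z * D1 F z y)
      = t * (t⁻¹ * (F (z + t) y - F z y) - D1 F z y) := by
    field_simp
    ring
  rw [e, norm_mul, add_sub_cancel_left, mul_comm] at key
  rw [dist_comm, dist_eq_norm]
  have := le_of_mul_le_mul_right key (norm_pos_iff.2 ht0')
  linarith

lemma SepHol.eventually_differenceQuotient {F : ℂ → ℂ → ℂ} {U V : Set ℂ} (hU : IsOpen U)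
    (h : SepHol F U V) {z : ℂ} (hz : z ∈ U) :
    ∀ᶠ t in 𝓝[≠] (0 : ℂ), z + t ∈ U ∧
      DifferentiableOn ℂ (fun v => t⁻¹ * (F (z + t) v - F z v)) V := by
  have : ∀ᶠ t in 𝓝 (0 : ℂ), z + t ∈ U :=
    (continuous_const.add continuous_id).continuousAt.eventually_mem (hU.mem_nhds (by simpa using hz))
  filter_upwards [mem_nhdsWithin_of_mem_nhds this] with t ht
  exact ⟨ht, ((h.snd _ ht).sub (h.snd _ hz)).const_mul _⟩

lemma SepHol.D1 {F : ℂ → ℂ → ℂ} {U V : Set ℂ} (hU : IsOpen U) (hV : IsOpen V)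
    (h : SepHol F U V) : SepHol (D1 F) U V where
  fst v hv := (h.fst v hv).deriv hU
  snd _ hz := (h.differenceQuotient_tendsto hU hV hz).differentiableOn
    ((h.eventually_differenceQuotient hU hz).mono fun _ ht => ht.2) hV
  cont _ hx := (h.continuousAt_D1 hU hV hx.1 hx.2).continuousWithinAt

lemma SepHol.D2 {F : ℂ → ℂ → ℂ} {U V : Set ℂ} (hU : IsOpen U) (hV : IsOpen V)
    (h : SepHol F U V) : SepHol (D2 F) U V :=
  (SepHol.D1 hV hU h.swap).swap

lemma SepHol.hasDerivAt_fst {F : ℂ → ℂ → ℂ} {U V : Set ℂ} (hU : IsOpen U)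
    (h : SepHol F U V) {z v : ℂ} (hz : z ∈ U) (hv : v ∈ V) :
    HasDerivAt (fun ζ => F ζ v) (LocalBergman.D1 F z v) z :=
  ((h.fst v hv).differentiableAt (hU.mem_nhds hz)).hasDerivAt

lemma SepHol.hasDerivAt_snd {F : ℂ → ℂ → ℂ} {U V : Set ℂ} (hV : IsOpen V)
    (h : SepHol F U V) {z v : ℂ} (hz : z ∈ U) (hv : v ∈ V) :
    HasDerivAt (F z) (LocalBergman.D2 F z v) v :=
  ((h.snd z hz).differentiableAt (hV.mem_nhds hv)).hasDerivAt

/-- The mixed partial derivatives agree. -/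
lemma SepHol.D2_D1 {F : ℂ → ℂ → ℂ} {U V : Set ℂ} (hU : IsOpen U) (hV : IsOpen V)
    (h : SepHol F U V) {z v : ℂ} (hz : z ∈ U) (hv : v ∈ V) :
    LocalBergman.D2 (LocalBergman.D1 F) z v = LocalBergman.D1 (LocalBergman.D2 F) z v := by
  have hq := h.eventually_differenceQuotient hU hz
  have h1 := ((h.differenceQuotient_tendsto hU hV hz).deriv (hq.mono fun _ ht => ht.2) hV).tendsto_at
    hv
  have h2 := hasDerivAt_iff_tendsto_slope_zero.1 ((h.D2 hU hV).hasDerivAt_fst hU hz hv)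
  refine tendsto_nhds_unique h1 (h2.congr' ?_)
  filter_upwards [hq] with t ht
  have := ((h.hasDerivAt_snd hV ht.1 hv).sub (h.hasDerivAt_snd hV hz hv)).const_mul t⁻¹
  simpa using this.deriv.symm

/-- Separately holomorphic functions are jointly differentiable. -/
lemma SepHol.hasFDerivAt {F : ℂ → ℂ → ℂ} {U V : Set ℂ} (hU : IsOpen U) (hV : IsOpen V)
    (h : SepHol F U V) {z v : ℂ} (hz : z ∈ U) (hv : v ∈ V) :
    HasFDerivAt (fun x : ℂ × ℂ => F x.1 x.2)
      ((ContinuousLinearMap.toSpanSingleton ℂ (LocalBergman.D1 F z v)).coprod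
        (ContinuousLinearMap.toSpanSingleton ℂ (LocalBergman.D2 F z v))) (z, v) := by
  have hmem := (hU.prod hV).mem_nhds (⟨hz, hv⟩ : (z, v) ∈ U ×ˢ V)
  have hcont : Continuous fun a : ℂ => ContinuousLinearMap.toSpanSingleton ℂ a :=
    (ContinuousLinearMap.toSpanSingletonLE ℂ ℂ ℂ).toLinearMap.continuous_of_finiteDimensional
  refine (hasStrictFDerivAt_uncurry_coprod (f := F) (u := (z, v))
    (f₁ := fun z v => ContinuousLinearMap.toSpanSingleton ℂ (LocalBergman.D1 F z v))
    (f₂ := fun z v => ContinuousLinearMap.toSpanSingleton ℂ (LocalBergman.D2 F z v))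
    ?_ ?_ ?_ ?_).hasFDerivAt
  · filter_upwards [hmem] with x hx
    exact (h.hasDerivAt_fst hU hx.1 hx.2).hasFDerivAt
  · filter_upwards [hmem] with x hx
    exact (h.hasDerivAt_snd hV hx.1 hx.2).hasFDerivAt
  · exact ContinuousAt.comp (f := fun x : ℂ × ℂ => LocalBergman.D1 F x.1 x.2)
      hcont.continuousAt (h.continuousAt_D1 hU hV hz hv)
  · exact ContinuousAt.comp (f := fun x : ℂ × ℂ => LocalBergman.D2 F x.1 x.2)
      hcont.continuousAt ((h.D2 hU hV).continuousAt hU hV hz hv)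

/-! ### Calculus of the Wirtinger derivatives -/

lemma wirtBar_of_hasFDerivAt {f : ℂ → ℂ} {L : ℂ →L[ℝ] ℂ} {z : ℂ} (h : HasFDerivAt f L z) :
    wirtBar f z = (L 1 + Complex.I * L Complex.I) / 2 := by
  rw [wirtBar, h.fderiv]

lemma wirt_of_hasFDerivAt {f : ℂ → ℂ} {L : ℂ →L[ℝ] ℂ} {z : ℂ} (h : HasFDerivAt f L z) :
    wirt f z = (L 1 - Complex.I * L Complex.I) / 2 := by
  rw [wirt, h.fderiv]

lemma wirtBar_congr {f g : ℂ → ℂ} {z : ℂ} (h : f =ᶠ[𝓝 z] g) : wirtBar f z = wirtBar g z := by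
  rw [wirtBar, wirtBar, h.fderiv_eq]

lemma wirt_congr {f g : ℂ → ℂ} {z : ℂ} (h : f =ᶠ[𝓝 z] g) : wirt f z = wirt g z := by
  rw [wirt, wirt, h.fderiv_eq]

lemma wirtBar_add {f g : ℂ → ℂ} {z : ℂ} (hf : DifferentiableAt ℝ f z)
    (hg : DifferentiableAt ℝ g z) :
    wirtBar (fun w => f w + g w) z = wirtBar f z + wirtBar g z := by
  rw [wirtBar_of_hasFDerivAt (hf.hasFDerivAt.fun_add hg.hasFDerivAt), wirtBar, wirtBar]
  simp only [_root_.add_apply]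
  ring

lemma wirtBar_sub {f g : ℂ → ℂ} {z : ℂ} (hf : DifferentiableAt ℝ f z)
    (hg : DifferentiableAt ℝ g z) :
    wirtBar (fun w => f w - g w) z = wirtBar f z - wirtBar g z := by
  rw [wirtBar_of_hasFDerivAt (hf.hasFDerivAt.fun_sub hg.hasFDerivAt), wirtBar, wirtBar]
  simp only [_root_.sub_apply]
  ring

lemma wirtBar_mul {f g : ℂ → ℂ} {z : ℂ} (hf : DifferentiableAt ℝ f z)
    (hg : DifferentiableAt ℝ g z) :
    wirtBar (fun w => f w * g w) z = wirtBar f z * g z + f z * wirtBar g z := by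
  rw [wirtBar_of_hasFDerivAt (hf.hasFDerivAt.fun_mul hg.hasFDerivAt), wirtBar, wirtBar]
  simp only [_root_.add_apply, _root_.smul_apply, smul_eq_mul]
  ring

lemma wirtBar_comp {g f : ℂ → ℂ} {g' z : ℂ} (hg : HasDerivAt g g' (f z))
    (hf : DifferentiableAt ℝ f z) :
    wirtBar (fun w => g (f w)) z = g' * wirtBar f z := by
  rw [wirtBar_of_hasFDerivAt (f := fun w => g (f w))
    ((hg.hasFDerivAt.restrictScalars ℝ).comp z hf.hasFDerivAt), wirtBar]
  simp only [ContinuousLinearMap.comp_apply, ContinuousLinearMap.coe_restrictScalars',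
    ContinuousLinearMap.toSpanSingleton_apply, smul_eq_mul]
  ring

lemma wirtBar_of_hasDerivAt {f : ℂ → ℂ} {f' z : ℂ} (h : HasDerivAt f f' z) :
    wirtBar f z = 0 := by
  rw [wirtBar_of_hasFDerivAt (h.hasFDerivAt.restrictScalars ℝ)]
  simp only [ContinuousLinearMap.coe_restrictScalars',
    ContinuousLinearMap.toSpanSingleton_apply, smul_eq_mul]
  linear_combination f' / 2 * Complex.I_mul_I

lemma wirt_of_hasDerivAt {f : ℂ → ℂ} {f' z : ℂ} (h : HasDerivAt f f' z) : wirt f z = f' := by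
  rw [wirt_of_hasFDerivAt (h.hasFDerivAt.restrictScalars ℝ)]
  simp only [ContinuousLinearMap.coe_restrictScalars',
    ContinuousLinearMap.toSpanSingleton_apply, smul_eq_mul]
  linear_combination -f' / 2 * Complex.I_mul_I

lemma hasFDerivAt_conj (z : ℂ) :
    HasFDerivAt (fun w : ℂ => conj w) (Complex.conjCLE : ℂ →L[ℝ] ℂ) z :=
  Complex.conjCLE.hasFDerivAt

lemma wirtBar_conj (z : ℂ) : wirtBar (fun w => conj w) z = 1 := by
  rw [wirtBar_of_hasFDerivAt (hasFDerivAt_conj z)]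
  simp

lemma wirtBar_const (c z : ℂ) : wirtBar (fun _ => c) z = 0 :=
  wirtBar_of_hasDerivAt (hasDerivAt_const z c)

lemma wirtBar_comp_conj {g : ℂ → ℂ} {g' w : ℂ} (hg : HasDerivAt g g' (conj w)) :
    wirtBar (fun ω => g (conj ω)) w = g' := by
  rw [wirtBar_comp hg (hasFDerivAt_conj w).differentiableAt, wirtBar_conj, mul_one]

lemma wirt_eq_conj_wirtBar (f : ℂ → ℂ) (z : ℂ) :
    wirt f z = conj (wirtBar (fun w => conj (f w)) z) := by
  have : fderiv ℝ (fun w => conj (f w)) z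
      = (Complex.conjCLE : ℂ →L[ℝ] ℂ).comp (fderiv ℝ f z) := Complex.conjCLE.comp_fderiv
  have h2 : conj (2 : ℂ) = 2 := Complex.conj_ofNat 2
  simp [wirt, wirtBar, this, sub_eq_add_neg, h2]

lemma contDiff_wirtBar {f : ℂ → ℂ} (hf : ContDiff ℝ ((⊤ : ℕ∞) : WithTop ℕ∞) f) :
    ContDiff ℝ ((⊤ : ℕ∞) : WithTop ℕ∞) (wirtBar f) := by
  have h : ContDiff ℝ ((⊤ : ℕ∞) : WithTop ℕ∞) (fderiv ℝ f) :=
    hf.fderiv_right (by simp)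
  unfold wirtBar
  exact ((h.clm_apply contDiff_const).add (contDiff_const.mul (h.clm_apply contDiff_const))).div_const
    _

lemma tsupport_wirtBar_subset (f : ℂ → ℂ) : tsupport (wirtBar f) ⊆ tsupport f := by
  refine closure_minimal (fun x hx => ?_) (isClosed_tsupport f)
  by_contra hxf
  apply hx
  have : f =ᶠ[𝓝 x] fun _ => 0 := notMem_tsupport_iff_eventuallyEq.1 hxf
  rw [wirtBar_congr this, wirtBar_const]

lemma wirtBar_eq_zero_of_eventuallyEq_zero {f : ℂ → ℂ} {z : ℂ} (h : f =ᶠ[𝓝 z] 0) :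
    wirtBar f z = 0 := by
  rw [wirtBar_congr (g := fun _ => 0) h, wirtBar_const]

lemma hasCompactSupport_wirtBar {f : ℂ → ℂ} (hf : HasCompactSupport f) :
    HasCompactSupport (wirtBar f) :=
  hf.of_isClosed_subset (isClosed_tsupport _) (tsupport_wirtBar_subset f)

/-! ### The polarization as a holomorphic function of two variables -/

/-- The polarization as a function holomorphic in both variables. -/
def polar (P : ℂ → ℂ → ℂ) (z v : ℂ) : ℂ := P z (conj v)

/-- Borel-Carathéodory recentred at `c` and made uniform on a smaller disk: a one-sided bound on the
real part, together with the value at the centre, controls the modulus. -/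
lemma norm_le_of_re_le {f : ℂ → ℂ} {c : ℂ} {R ρ M N : ℝ} (hM : 0 < M) (hρ : 0 ≤ ρ) (hR : ρ < R)
    (hf : DifferentiableOn ℂ f (ball c R)) (hre : ∀ x ∈ ball c R, (f x).re ≤ M)
    (hN : ‖f c‖ ≤ N) {x : ℂ} (hx : x ∈ closedBall c ρ) :
    ‖f x‖ ≤ (2 * M * R + N * (2 * R)) / (R - ρ) := by
  have hR0 : 0 < R := hρ.trans_lt hR
  have hxn : ‖x - c‖ ≤ ρ := by simpa [dist_eq_norm] using hx
  have hmap : MapsTo (fun y : ℂ => c + y) (ball 0 R) (ball c R) := by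
    intro y hy
    simpa using hy
  have h := Complex.borelCaratheodory (f := fun y => f (c + y)) (R := R) (z := x - c) hM
    (hf.comp (by fun_prop) hmap)
    (fun y hy => hre _ (hmap hy)) hR0 (by simpa using hxn.trans_lt hR)
  simp only [add_sub_cancel, add_zero] at h
  have h1 : 0 < R - ρ := by linarith
  have hN0 : 0 ≤ N := (norm_nonneg _).trans hN
  calc ‖f x‖ ≤ 2 * M * ‖x - c‖ / (R - ‖x - c‖) + ‖f c‖ * (R + ‖x - c‖) / (R - ‖x - c‖) := h
    _ = (2 * M * ‖x - c‖ + ‖f c‖ * (R + ‖x - c‖)) / (R - ‖x - c‖) := by ring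
    _ ≤ (2 * M * R + N * (2 * R)) / (R - ρ) := by
      gcongr
      · linarith
      · linarith

lemma conj_mem_ball {z c : ℂ} {r : ℝ} : conj z ∈ ball (conj c) r ↔ z ∈ ball c r := by
  simp only [mem_ball, dist_eq_norm, ← map_sub, RCLike.norm_conj]

lemma IsAdmissible.lapl_pos {Q : ℂ → ℝ} {P : ℂ → ℂ → ℂ} {z₀ : ℂ} {r : ℝ}
    (h : IsAdmissible Q P z₀ r) : 0 < lapl Q z₀ := by
  obtain ⟨ε, hε, hl⟩ := h.lapl_bound
  exact hε.trans (hl z₀ (mem_ball_self h.radius_pos))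

lemma IsAdmissible.re_le {Q : ℂ → ℝ} {P : ℂ → ℂ → ℂ} {z₀ : ℂ} {r : ℝ}
    (h : IsAdmissible Q P z₀ r) {z w : ℂ} (hz : z ∈ ball z₀ r) (hw : w ∈ ball z₀ r) :
    (P z w).re ≤ (Q z + Q w) / 2 := by
  have h1 := h.decay z hz w hw
  have h2 : 0 ≤ lapl Q z₀ * ‖w - z‖ ^ 2 := mul_nonneg h.lapl_pos.le (sq_nonneg _)
  linarith

/-- Local boundedness comes from `Re P(z,w) ≤ (Q(z)+Q(w))/2` and two uses of Borel-Carathéodory: in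
the second variable, starting from `P(z₀,z₀) = Q(z₀)`, and then in the first one, starting from the
resulting bound `N` on `P(z₀,·)`. -/
lemma IsAdmissible.sepHol {Q : ℂ → ℝ} (hQ : Continuous Q) {P : ℂ → ℂ → ℂ} {z₀ : ℂ} {r : ℝ}
    (h : IsAdmissible Q P z₀ r) : SepHol (polar P) (ball z₀ r) (ball (conj z₀) r) := by
  have hmem : ∀ v ∈ ball (conj z₀) r, conj v ∈ ball z₀ r := by
    intro v hv
    rw [← conj_mem_ball]
    simpa using hv
  refine SepHol.of_locally_bounded isOpen_ball isOpen_ball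
    (fun v hv => (h.polarization.analytic_fst _ (hmem v hv)).differentiableOn)
    (fun z hz v hv => ?_) (fun z hz v hv => ?_)
  · have h1 := (h.polarization.antianalytic_snd z hz _ (hmem v hv)).differentiableAt.hasDerivAt
    have h2 := h1.conj_conj
    have e : (⇑(starRingEnd ℂ) ∘ (fun w => conj (P z w)) ∘ ⇑(starRingEnd ℂ)) = polar P z := by
      ext v
      simp [polar]
    rw [e, Complex.conj_conj] at h2
    exact h2.differentiableAt.differentiableWithinAt
  · have hw := hmem v hv
    obtain ⟨ρ, hρ, hρr⟩ : ∃ ρ, max (dist z z₀) (dist (conj v) z₀) < ρ ∧ ρ < r :=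
      exists_between (max_lt hz hw)
    obtain ⟨R, hρR, hRr⟩ := exists_between hρr
    have hρ0 : 0 ≤ ρ := dist_nonneg.trans ((le_max_left _ _).trans hρ.le)
    obtain ⟨M, hM⟩ := (isCompact_closedBall z₀ R).exists_bound_of_continuousOn hQ.continuousOn
    have hM0 : 0 ≤ M := (norm_nonneg _).trans (hM z₀ (mem_closedBall_self (hρ0.trans hρR.le)))
    have hsub : ball z₀ R ⊆ ball z₀ r := ball_subset_ball hRr.le
    -- `M + 1` rather than `M`, since Borel-Carathéodory asks for a strictly positive bound.
    have hre : ∀ s ∈ ball z₀ R, ∀ t ∈ ball z₀ R, (P s t).re ≤ M + 1 := by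
      intro s hs t ht
      have h1 := h.re_le (hsub hs) (hsub ht)
      have h2 := (le_abs_self _).trans (hM s (ball_subset_closedBall hs))
      have h3 := (le_abs_self _).trans (hM t (ball_subset_closedBall ht))
      linarith
    have hc : z₀ ∈ ball z₀ R := mem_ball_self (hρ0.trans_lt hρR)
    set N := (2 * (M + 1) * R + M * (2 * R)) / (R - ρ) with hN
    have hfirst : ∀ t ∈ closedBall z₀ ρ, ‖P z₀ t‖ ≤ N := by
      intro t ht
      have := norm_le_of_re_le (f := fun t => conj (P z₀ t)) (M := M + 1) (N := M) (by linarith)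
        hρ0 hρR ((h.polarization.antianalytic_snd z₀ (hsub hc)).differentiableOn.mono hsub)
        (fun x hx => by simpa using hre z₀ hc x hx)
        (by
          rw [RCLike.norm_conj, h.polarization.diag _ (hsub hc), Complex.norm_real]
          exact hM z₀ (ball_subset_closedBall hc)) ht
      rwa [RCLike.norm_conj] at this
    refine ⟨(2 * (M + 1) * R + N * (2 * R)) / (R - ρ), ?_⟩
    have hopen : ball z₀ ρ ×ˢ ball (conj z₀) ρ ∈ 𝓝 (z, v) := by
      refine prod_mem_nhds (isOpen_ball.mem_nhds ((le_max_left _ _).trans_lt hρ))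
        (isOpen_ball.mem_nhds ?_)
      rw [← Complex.conj_conj v, conj_mem_ball]
      exact (le_max_right _ _).trans_lt hρ
    filter_upwards [hopen] with x hx
    have hx2 : conj x.2 ∈ ball z₀ ρ := by
      rw [← conj_mem_ball]
      simpa using hx.2
    have hx2R := ball_subset_ball hρR.le hx2
    exact norm_le_of_re_le (f := fun s => P s (conj x.2)) (by linarith) hρ0 hρR
      ((h.polarization.analytic_fst _ (hsub hx2R)).differentiableOn.mono hsub)
      (fun s hs => hre s hs _ hx2R) (hfirst _ (ball_subset_closedBall hx2))
      (ball_subset_closedBall hx.1)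

lemma SepHol.wirt_eq {F : ℂ → ℂ → ℂ} {U V : Set ℂ} (hU : IsOpen U) (h : SepHol F U V) {g : ℂ → ℂ}
    {z v : ℂ} (hz : z ∈ U) (hv : v ∈ V) (hg : ∀ ζ ∈ U, g ζ = F ζ v) :
    wirt g z = LocalBergman.D1 F z v := by
  rw [wirt_congr (g := fun ζ => F ζ v) (Filter.eventuallyEq_of_mem (hU.mem_nhds hz) hg)]
  exact wirt_of_hasDerivAt (h.hasDerivAt_fst hU hz hv)

lemma SepHol.wirtBar_eq {F : ℂ → ℂ → ℂ} {U : Set ℂ} {c : ℂ} {r : ℝ}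
    (h : SepHol F U (ball (conj c) r)) {g : ℂ → ℂ} {z w : ℂ} (hz : z ∈ U) (hw : w ∈ ball c r)
    (hg : ∀ ω ∈ ball c r, g ω = F z (conj ω)) : wirtBar g w = LocalBergman.D2 F z (conj w) := by
  rw [wirtBar_congr (g := fun ω => F z (conj ω))
    (Filter.eventuallyEq_of_mem (isOpen_ball.mem_nhds hw) hg)]
  exact wirtBar_comp_conj (h.hasDerivAt_snd isOpen_ball hz (conj_mem_ball.2 hw))

/-- The function `b` as a holomorphic function of two variables. -/
def bHol (P : ℂ → ℂ → ℂ) : ℂ → ℂ → ℂ := D1 (D2 (polar P))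

lemma sepHol_bHol {P : ℂ → ℂ → ℂ} {z₀ : ℂ} {r : ℝ}
    (h : SepHol (polar P) (ball z₀ r) (ball (conj z₀) r)) :
    SepHol (bHol P) (ball z₀ r) (ball (conj z₀) r) :=
  (h.D2 isOpen_ball isOpen_ball).D1 isOpen_ball isOpen_ball

lemma bfun_eq {P : ℂ → ℂ → ℂ} {z₀ : ℂ} {r : ℝ}
    (h : SepHol (polar P) (ball z₀ r) (ball (conj z₀) r))
    {z w : ℂ} (hz : z ∈ ball z₀ r) (hw : w ∈ ball z₀ r) :
    bfun P z w = bHol P z (conj w) :=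
  (h.D2 isOpen_ball isOpen_ball).wirt_eq isOpen_ball hz (conj_mem_ball.2 hw) fun ζ hζ =>
    h.wirtBar_eq hζ hw fun ω _ => by simp [polar]

lemma wirt_bfun_eq {P : ℂ → ℂ → ℂ} {z₀ : ℂ} {r : ℝ}
    (h : SepHol (polar P) (ball z₀ r) (ball (conj z₀) r))
    {z w : ℂ} (hz : z ∈ ball z₀ r) (hw : w ∈ ball z₀ r) :
    wirt (fun ζ => bfun P ζ w) z = D1 (bHol P) z (conj w) :=
  (sepHol_bHol h).wirt_eq isOpen_ball hz (conj_mem_ball.2 hw) fun _ hζ => bfun_eq h hζ hw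

lemma wirtBar_bfun_eq {P : ℂ → ℂ → ℂ} {z₀ : ℂ} {r : ℝ}
    (h : SepHol (polar P) (ball z₀ r) (ball (conj z₀) r))
    {z w : ℂ} (hz : z ∈ ball z₀ r) (hw : w ∈ ball z₀ r) :
    wirtBar (fun ω => bfun P z ω) w = D2 (bHol P) z (conj w) :=
  (sepHol_bHol h).wirtBar_eq hz hw fun _ hω => bfun_eq h hz hω

lemma wirtBar_wirt_bfun_eq {P : ℂ → ℂ → ℂ} {z₀ : ℂ} {r : ℝ}
    (h : SepHol (polar P) (ball z₀ r) (ball (conj z₀) r))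
    {z w : ℂ} (hz : z ∈ ball z₀ r) (hw : w ∈ ball z₀ r) :
    wirtBar (fun ω => wirt (fun ζ => bfun P ζ ω) z) w = D2 (D1 (bHol P)) z (conj w) :=
  ((sepHol_bHol h).D1 isOpen_ball isOpen_ball).wirtBar_eq hz hw fun _ hω => wirt_bfun_eq h hz hω

/-! ### Integration by parts and weak bianalyticity -/

instance isAddHaarMeasure_areaMeasure : areaMeasure.IsAddHaarMeasure :=
  Measure.IsAddHaarMeasure.smul _ (by simp [Real.pi_pos]) ENNReal.ofReal_ne_top

lemma continuous_fderiv_apply {f : ℂ → ℂ} (hf : ContDiff ℝ 1 f) (v : ℂ) :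
    Continuous fun z => fderiv ℝ f z v :=
  (hf.continuous_fderiv one_ne_zero).clm_apply continuous_const

lemma integrable_fderiv_apply {f : ℂ → ℂ} (hf : ContDiff ℝ 1 f) (hc : HasCompactSupport f)
    (v : ℂ) : Integrable (fun z => fderiv ℝ f z v) areaMeasure :=
  (continuous_fderiv_apply hf v).integrable_of_hasCompactSupport (hc.fderiv_apply ℝ v)

lemma integral_fderiv_apply_eq_zero {f : ℂ → ℂ} (hf : ContDiff ℝ 1 f) (hc : HasCompactSupport f)
    (v : ℂ) : ∫ z, fderiv ℝ f z v ∂areaMeasure = 0 := by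
  have h := integral_mul_fderiv_eq_neg_fderiv_mul_of_integrable (μ := areaMeasure)
    (f := fun _ : ℂ => (1 : ℂ)) (g := f) (v := v) (by simp)
    (by simpa using integrable_fderiv_apply hf hc v)
    (by simpa using hf.continuous.integrable_of_hasCompactSupport hc)
    (fun _ _ => differentiableAt_const _) (fun _ _ => hf.differentiable one_ne_zero _)
  simpa using h

lemma integral_wirtBar_eq_zero {f : ℂ → ℂ} (hf : ContDiff ℝ 1 f) (hc : HasCompactSupport f) :
    ∫ z, wirtBar f z ∂areaMeasure = 0 := by
  unfold wirtBar
  rw [integral_div, integral_add (integrable_fderiv_apply hf hc 1)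
    ((integrable_fderiv_apply hf hc _).const_mul _), integral_const_mul,
    integral_fderiv_apply_eq_zero hf hc, integral_fderiv_apply_eq_zero hf hc]
  simp

lemma contDiffAt_of_differentiableOn {A : ℂ → ℂ} {U : Set ℂ} (hU : IsOpen U)
    (hA : DifferentiableOn ℂ A U) {w : ℂ} (hw : w ∈ U) {n : WithTop ℕ∞} : ContDiffAt ℝ n A w :=
  ((hA.analyticAt (hU.mem_nhds hw)).contDiffAt).restrict_scalars ℝ

/-- Functions of the form `A + (z̄ - v) B` with `A` and `B` holomorphic are bianalytic. -/
lemma isPolyanalyticOn_two {f A B : ℂ → ℂ} {U : Set ℂ} (hU : IsOpen U) (v : ℂ)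
    (hA : DifferentiableOn ℂ A U) (hB : DifferentiableOn ℂ B U)
    (hf : ∀ z ∈ U, f z = A z + (conj z - v) * B z) : IsPolyanalyticOn 2 f U := by
  have hconj : ContDiff ℝ (⊤ : WithTop ℕ∞) fun z : ℂ => conj z - v :=
    Complex.conjCLE.contDiff.sub contDiff_const
  have hfe : ∀ z ∈ U, f =ᶠ[𝓝 z] fun z => A z + (conj z - v) * B z := fun z hz =>
    Filter.eventuallyEq_of_mem (hU.mem_nhds hz) hf
  have hfc : ∀ z ∈ U, ContDiffAt ℝ 1 f z := fun z hz =>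
    ((contDiffAt_of_differentiableOn hU hA hz).add ((hconj.of_le le_top).contDiffAt.mul
      (contDiffAt_of_differentiableOn hU hB hz))).congr_of_eventuallyEq (hfe z hz)
  refine ⟨fun z hz => (hfc z hz).continuousAt.continuousWithinAt, fun φ hφ => ?_⟩
  have hφ1 := contDiff_wirtBar hφ.smooth
  have hone : (1 : WithTop ℕ∞) ≤ ((⊤ : ℕ∞) : WithTop ℕ∞) := by exact_mod_cast le_top
  -- Here `B = ∂̄f` and `∂̄B = 0`, so `∂̄ψ = f ∂̄²φ` on the support of `φ`: the integrand is the
  -- `∂̄` of a compactly supported function and has integral zero.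
  set ψ : ℂ → ℂ := fun z => f z * wirtBar φ z - B z * φ z with hψ
  have hzero : ∀ z, z ∉ tsupport φ → φ =ᶠ[𝓝 z] 0 ∧ wirtBar φ =ᶠ[𝓝 z] 0 := fun z hz =>
    ⟨notMem_tsupport_iff_eventuallyEq.1 hz,
      notMem_tsupport_iff_eventuallyEq.1 fun h => hz (tsupport_wirtBar_subset φ h)⟩
  have hψ0 : ∀ z, z ∉ tsupport φ → ψ =ᶠ[𝓝 z] 0 := fun z hz => by
    filter_upwards [(hzero z hz).1, (hzero z hz).2] with x h1 h2
    simp [hψ, h1, h2]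
  have hψc : ContDiff ℝ 1 ψ := by
    rw [contDiff_iff_contDiffAt]
    intro z
    by_cases hz : z ∈ tsupport φ
    · have hzU := hφ.supp hz
      exact ((hfc z hzU).mul (hφ1.of_le hone).contDiffAt).sub
        ((contDiffAt_of_differentiableOn hU hB hzU).mul (hφ.smooth.of_le hone).contDiffAt)
    · exact contDiffAt_const.congr_of_eventuallyEq (hψ0 z hz)
  have hψs : HasCompactSupport ψ := by
    refine hφ.compact.of_isClosed_subset (isClosed_tsupport _)
      (closure_minimal (fun z hz => ?_) (isClosed_tsupport φ))
    by_contra h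
    exact hz (hψ0 z h).self_of_nhds
  rw [← integral_wirtBar_eq_zero hψc hψs]
  congr 1
  ext z
  change f z * wirtBar (wirtBar φ) z = _
  by_cases hz : z ∈ tsupport φ
  · have hzU := hφ.supp hz
    have hAd := (contDiffAt_of_differentiableOn (n := 1) hU hA hzU).differentiableAt one_ne_zero
    have hBd := (contDiffAt_of_differentiableOn (n := 1) hU hB hzU).differentiableAt one_ne_zero
    have hcd : DifferentiableAt ℝ (fun z : ℂ => conj z - v) z :=
      (hconj.differentiable (by simp)) z
    have hfd := (hfc z hzU).differentiableAt one_ne_zero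
    have hφd : DifferentiableAt ℝ φ z := hφ.smooth.differentiable (by simp) z
    have hφ1d : DifferentiableAt ℝ (wirtBar φ) z := hφ1.differentiable (by simp) z
    have hA0 : wirtBar A z = 0 :=
      wirtBar_of_hasDerivAt (hA.differentiableAt (hU.mem_nhds hzU)).hasDerivAt
    have hB0 : wirtBar B z = 0 :=
      wirtBar_of_hasDerivAt (hB.differentiableAt (hU.mem_nhds hzU)).hasDerivAt
    have hc1 : wirtBar (fun z : ℂ => conj z - v) z = 1 := by
      rw [wirtBar_sub (hasFDerivAt_conj z).differentiableAt (differentiableAt_const v),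
        wirtBar_conj, wirtBar_const, sub_zero]
    have hf1 : wirtBar f z = B z := by
      rw [wirtBar_congr (hfe z hzU), wirtBar_add hAd (hcd.fun_mul hBd), wirtBar_mul hcd hBd, hA0, hB0,
        hc1]
      ring
    rw [hψ, wirtBar_sub (hfd.fun_mul hφ1d) (hBd.fun_mul hφd), wirtBar_mul hfd hφ1d, wirtBar_mul hBd hφd,
      hf1, hB0]
    ring
  · rw [wirtBar_eq_zero_of_eventuallyEq_zero (hψ0 z hz),
      wirtBar_eq_zero_of_eventuallyEq_zero (hzero z hz).2, mul_zero]

lemma IsTest.conj {U : Set ℂ} {φ : ℂ → ℂ} (h : IsTest U φ) : IsTest U fun z => conj (φ z) := by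
  have hs : tsupport (fun z => conj (φ z)) = tsupport φ := by
    unfold tsupport
    congr 1
    ext z
    simp
  exact ⟨Complex.conjCLE.contDiff.comp h.smooth, by rw [HasCompactSupport, hs]; exact h.compact,
    hs ▸ h.supp⟩

lemma IsPolyanalyticOn.conj {f : ℂ → ℂ} {U : Set ℂ}
    (h : IsPolyanalyticOn 2 (fun z => conj (f z)) U) : IsConjPolyanalyticOn 2 f U := by
  refine ⟨by simpa [Function.comp_def] using Complex.continuous_conj.comp_continuousOn h.1, fun φ hφ => ?_⟩
  have h1 := h.2 _ hφ.conj
  change ∫ z, _ * wirtBar (wirtBar fun z => conj (φ z)) z ∂_ = 0 at h1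
  change ∫ z, _ * wirt (wirt φ) z ∂_ = 0
  have e : wirt φ = fun z => conj (wirtBar (fun w => conj (φ w)) z) :=
    funext fun z => wirt_eq_conj_wirtBar φ z
  have e2 : ∀ z, f z * wirt (wirt φ) z
      = conj (conj (f z) * wirtBar (wirtBar fun z => conj (φ z)) z) := by
    intro z
    rw [wirt_eq_conj_wirtBar (wirt φ), e]
    simp
  simp_rw [e2]
  rw [integral_conj, h1, map_zero]

/-! ### The kernel and its analyticity in each variable -/

/-- The amplitude of the kernel, with `z̄` and `w̄` replaced by independent variables. -/
def amp (P : ℂ → ℂ → ℂ) (m : ℝ) (z z' w v : ℂ) : ℂ :=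
  (m : ℂ) ^ 2 * (-((z - w) * (z' - v)) * bHol P z v ^ 2)
    + m * (2 * bHol P z v + (z - w) * D1 (bHol P) z v - (z' - v) * D2 (bHol P) z v
      + (z - w) * (z' - v) * (-(3 / 2) * D2 (D1 (bHol P)) z v
        + D1 (bHol P) z v * D2 (bHol P) z v / bHol P z v))

lemma norm_sub_sq_eq (z w : ℂ) : (‖z - w‖ : ℂ) ^ 2 = (z - w) * (conj z - conj w) := by
  rw [← map_sub, Complex.mul_conj, Complex.normSq_eq_norm_sq]
  push_cast
  rfl

lemma twoTermKernel_eq {P : ℂ → ℂ → ℂ} {z₀ : ℂ} {r : ℝ}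
    (h : SepHol (polar P) (ball z₀ r) (ball (conj z₀) r))
    {z w : ℂ} (hz : z ∈ ball z₀ r) (hw : w ∈ ball z₀ r) (m : ℝ) :
    twoTermKernel P m z w
      = amp P m z (conj z) w (conj w) * Complex.exp (m * polar P z (conj w)) := by
  rw [twoTermKernel, coeff0, coeff1, wirtBar_wirt_bfun_eq h hz hw, wirtBar_bfun_eq h hz hw,
    wirt_bfun_eq h hz hw, bfun_eq h hz hw, norm_sub_sq_eq, amp, polar, Complex.conj_conj]

lemma IsAdmissible.bHol_ne {Q : ℂ → ℝ} (hQ : Continuous Q) {P : ℂ → ℂ → ℂ} {z₀ : ℂ} {r : ℝ}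
    (h : IsAdmissible Q P z₀ r) {z v : ℂ} (hz : z ∈ ball z₀ r) (hv : v ∈ ball (conj z₀) r) :
    bHol P z v ≠ 0 := by
  have hw : conj v ∈ ball z₀ r := by
    rw [← conj_mem_ball]
    simpa using hv
  have := h.bfun_ne z hz _ hw
  rwa [bfun_eq (h.sepHol hQ) hz hw, Complex.conj_conj] at this

lemma IsAdmissible.polyanalytic_fst {Q : ℂ → ℝ} (hQ : Continuous Q) {P : ℂ → ℂ → ℂ} {z₀ : ℂ}
    {r : ℝ} (h : IsAdmissible Q P z₀ r) (m : ℝ) {w : ℂ} (hw : w ∈ ball z₀ r) :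
    IsPolyanalyticOn 2 (fun z => twoTermKernel P m z w) (ball z₀ r) := by
  have hH := h.sepHol hQ
  have hb := sepHol_bHol hH
  have hv : conj w ∈ ball (conj z₀) r := conj_mem_ball.2 hw
  have d := hb.fst _ hv
  have d1 := (hb.D1 isOpen_ball isOpen_ball).fst _ hv
  have d2 := (hb.D2 isOpen_ball isOpen_ball).fst _ hv
  have d12 := ((hb.D1 isOpen_ball isOpen_ball).D2 isOpen_ball isOpen_ball).fst _ hv
  have de : DifferentiableOn ℂ (fun z => Complex.exp (m * polar P z (conj w))) (ball z₀ r) :=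
    ((hH.fst _ hv).const_mul _).cexp
  have dw : DifferentiableOn ℂ (fun z => z - w) (ball z₀ r) := by fun_prop
  refine isPolyanalyticOn_two isOpen_ball (conj w)
    (A := fun z => m * (2 * bHol P z (conj w) + (z - w) * D1 (bHol P) z (conj w))
      * Complex.exp (m * polar P z (conj w)))
    (B := fun z => ((m : ℂ) ^ 2 * (-(z - w) * bHol P z (conj w) ^ 2)
      + m * (-D2 (bHol P) z (conj w)
        + (z - w) * (-(3 / 2) * D2 (D1 (bHol P)) z (conj w)
          + D1 (bHol P) z (conj w) * D2 (bHol P) z (conj w) / bHol P z (conj w))))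
      * Complex.exp (m * polar P z (conj w))) ?_ ?_ fun z hz => ?_
  · exact (((d.const_mul 2).add (dw.mul d1)).const_mul _).mul de
  · exact (((dw.neg.mul (d.pow 2)).const_mul _).add ((d2.neg.add (dw.mul ((d12.const_mul _).add
      ((d1.mul d2).div d fun z hz => h.bHol_ne hQ hz hv)))).const_mul _)).mul de
  · rw [twoTermKernel_eq hH hz hw, amp]
    ring

/-- The kernel has degree one in `w - z`, with coefficients holomorphic in `w̄` because `b` has no
zeros. Both real analyticity and conjugate bianalyticity in `w` follow from this form. -/
lemma IsAdmissible.exists_snd_decomposition {Q : ℂ → ℝ} (hQ : Continuous Q) {P : ℂ → ℂ → ℂ}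
    {z₀ : ℂ} {r : ℝ} (h : IsAdmissible Q P z₀ r) (m : ℝ) {z : ℂ} (hz : z ∈ ball z₀ r) :
    ∃ A B : ℂ → ℂ, DifferentiableOn ℂ A (ball (conj z₀) r) ∧
      DifferentiableOn ℂ B (ball (conj z₀) r) ∧
      ∀ w ∈ ball z₀ r, twoTermKernel P m z w = A (conj w) + (w - z) * B (conj w) := by
  have hH := h.sepHol hQ
  have hb := sepHol_bHol hH
  have d := hb.snd _ hz
  have d1 := (hb.D1 isOpen_ball isOpen_ball).snd _ hz
  have d2 := (hb.D2 isOpen_ball isOpen_ball).snd _ hz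
  have d12 := ((hb.D1 isOpen_ball isOpen_ball).D2 isOpen_ball isOpen_ball).snd _ hz
  have de : DifferentiableOn ℂ (fun v => Complex.exp (m * polar P z v)) (ball (conj z₀) r) :=
    ((hH.snd _ hz).const_mul _).cexp
  have dw : DifferentiableOn ℂ (fun v => conj z - v) (ball (conj z₀) r) := by fun_prop
  refine ⟨fun v => m * (2 * bHol P z v - (conj z - v) * D2 (bHol P) z v)
      * Complex.exp (m * polar P z v),
    fun v => ((m : ℂ) ^ 2 * ((conj z - v) * bHol P z v ^ 2)
      + m * (-D1 (bHol P) z v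
        - (conj z - v) * (-(3 / 2) * D2 (D1 (bHol P)) z v
          + D1 (bHol P) z v * D2 (bHol P) z v / bHol P z v)))
      * Complex.exp (m * polar P z v), ?_, ?_, fun w hw => ?_⟩
  · exact (((d.const_mul 2).sub (dw.mul d2)).const_mul _).mul de
  · exact (((dw.mul (d.pow 2)).const_mul _).add ((d1.neg.sub (dw.mul ((d12.const_mul _).add
      ((d1.mul d2).div d fun v hv => h.bHol_ne hQ hz hv)))).const_mul _)).mul de
  · rw [twoTermKernel_eq hH hz hw, amp]
    ring

lemma differentiableOn_conj_conj {A : ℂ → ℂ} {c : ℂ} {r : ℝ}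
    (hA : DifferentiableOn ℂ A (ball (conj c) r)) :
    DifferentiableOn ℂ (fun w => conj (A (conj w))) (ball c r) := by
  intro w hw
  have := ((hA.differentiableAt (isOpen_ball.mem_nhds (conj_mem_ball.2 hw))).hasDerivAt).conj_conj
  rw [Complex.conj_conj] at this
  exact this.differentiableAt.differentiableWithinAt

lemma IsAdmissible.conjPolyanalytic_snd {Q : ℂ → ℝ} (hQ : Continuous Q) {P : ℂ → ℂ → ℂ}
    {z₀ : ℂ} {r : ℝ} (h : IsAdmissible Q P z₀ r) (m : ℝ) {z : ℂ} (hz : z ∈ ball z₀ r) :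
    IsConjPolyanalyticOn 2 (fun w => twoTermKernel P m z w) (ball z₀ r) := by
  obtain ⟨A, B, hA, hB, hAB⟩ := h.exists_snd_decomposition hQ m hz
  apply IsPolyanalyticOn.conj
  refine isPolyanalyticOn_two isOpen_ball (conj z) (differentiableOn_conj_conj hA)
    (differentiableOn_conj_conj hB) fun w hw => ?_
  simp [hAB w hw]

lemma analyticAt_comp_conj {A : ℂ → ℂ} {c : ℂ} {r : ℝ}
    (hA : DifferentiableOn ℂ A (ball (conj c) r)) {w : ℂ} (hw : w ∈ ball c r) :
    AnalyticAt ℝ (fun w => A (conj w)) w := by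
  have h1 : AnalyticAt ℂ A (conj w) :=
    hA.analyticAt (isOpen_ball.mem_nhds (conj_mem_ball.2 hw))
  exact h1.restrictScalars.comp (g := A) (f := fun w : ℂ => conj w)
    ((Complex.conjCLE : ℂ →L[ℝ] ℂ).analyticAt w)

lemma IsAdmissible.analytic_snd {Q : ℂ → ℝ} (hQ : Continuous Q) {P : ℂ → ℂ → ℂ}
    {z₀ : ℂ} {r : ℝ} (h : IsAdmissible Q P z₀ r) (m : ℝ) {z : ℂ} (hz : z ∈ ball z₀ r) :
    AnalyticOnNhd ℝ (fun w => twoTermKernel P m z w) (ball z₀ r) := by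
  obtain ⟨A, B, hA, hB, hAB⟩ := h.exists_snd_decomposition hQ m hz
  intro w hw
  refine ((analyticAt_comp_conj hA hw).add ((analyticAt_id.sub (analyticAt_const (v := z))).mul
    (analyticAt_comp_conj hB hw))).congr ?_
  filter_upwards [isOpen_ball.mem_nhds hw] with x hx
  exact (hAB x hx).symm

/-! ### A calculus of pointwise `∂̄`-derivatives -/

/-- `f` is real differentiable at `z`, with `∂̄ f (z) = f'`. -/
structure HasWirtBarAt (f : ℂ → ℂ) (f' z : ℂ) : Prop where
  differentiableAt : DifferentiableAt ℝ f z
  wirtBar_eq : wirtBar f z = f'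

namespace HasWirtBarAt

variable {f g : ℂ → ℂ} {f' g' z : ℂ}

lemma add (hf : HasWirtBarAt f f' z) (hg : HasWirtBarAt g g' z) :
    HasWirtBarAt (fun w => f w + g w) (f' + g') z :=
  ⟨hf.1.fun_add hg.1, by rw [wirtBar_add hf.1 hg.1, hf.2, hg.2]⟩

lemma sub (hf : HasWirtBarAt f f' z) (hg : HasWirtBarAt g g' z) :
    HasWirtBarAt (fun w => f w - g w) (f' - g') z :=
  ⟨hf.1.fun_sub hg.1, by rw [wirtBar_sub hf.1 hg.1, hf.2, hg.2]⟩

lemma mul (hf : HasWirtBarAt f f' z) (hg : HasWirtBarAt g g' z) :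
    HasWirtBarAt (fun w => f w * g w) (f' * g z + f z * g') z :=
  ⟨hf.1.fun_mul hg.1, by rw [wirtBar_mul hf.1 hg.1, hf.2, hg.2]⟩

lemma of_hasDerivAt (h : HasDerivAt f f' z) : HasWirtBarAt f 0 z :=
  ⟨h.differentiableAt.restrictScalars ℝ, wirtBar_of_hasDerivAt h⟩

lemma const (c z : ℂ) : HasWirtBarAt (fun _ => c) 0 z := of_hasDerivAt (hasDerivAt_const z c)

lemma const_mul (c : ℂ) (hf : HasWirtBarAt f f' z) : HasWirtBarAt (fun w => c * f w) (c * f') z := by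
  simpa using (const c z).mul hf

lemma comp {h : ℂ → ℂ} {h' : ℂ} (hh : HasDerivAt h h' (f z)) (hf : HasWirtBarAt f f' z) :
    HasWirtBarAt (fun w => h (f w)) (h' * f') z :=
  ⟨(hh.differentiableAt.restrictScalars ℝ).comp z hf.1, by rw [wirtBar_comp hh hf.1, hf.2]⟩

lemma conj_id (z : ℂ) : HasWirtBarAt (fun w => conj w) 1 z :=
  ⟨(hasFDerivAt_conj z).differentiableAt, wirtBar_conj z⟩

lemma congr (hf : HasWirtBarAt f f' z) (h : g =ᶠ[𝓝 z] f) : HasWirtBarAt g f' z :=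
  ⟨hf.1.congr_of_eventuallyEq h, by rw [wirtBar_congr h, hf.2]⟩

lemma of_contDiff (hf : ContDiff ℝ ((⊤ : ℕ∞) : WithTop ℕ∞) f) (z : ℂ) :
    HasWirtBarAt f (wirtBar f z) z :=
  ⟨hf.differentiable (by simp) z, rfl⟩

end HasWirtBarAt

/-! ### The regularized fundamental solution of `∂̄²` -/

/-- The denominator `c² |w - z|² + 1`. -/
def regDen (c : ℝ) (z w : ℂ) : ℂ := (c : ℂ) ^ 2 * ((w - z) * (conj w - conj z)) + 1

/-- A regularization of `(w̄ - z̄) / (w - z)`, which is the fundamental solution of `∂̄²`. -/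
def regSol (c : ℝ) (z w : ℂ) : ℂ :=
  (c : ℂ) ^ 2 * ((conj w - conj z) * (conj w - conj z)) * (regDen c z w)⁻¹

/-- The `∂̄`-derivative of `regSol`. -/
def regSol₁ (c : ℝ) (z w : ℂ) : ℂ :=
  (c : ℂ) ^ 2 * ((conj w - conj z) * (regDen c z w + 1)) * ((regDen c z w)⁻¹ * (regDen c z w)⁻¹)

lemma regDen_eq (c : ℝ) (z w : ℂ) : regDen c z w = ((c ^ 2 * ‖w - z‖ ^ 2 + 1 : ℝ) : ℂ) := by
  rw [regDen, ← norm_sub_sq_eq]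
  push_cast
  rfl

lemma regDen_ne_zero (c : ℝ) (z w : ℂ) : regDen c z w ≠ 0 := by
  rw [regDen_eq, Complex.ofReal_ne_zero]
  positivity

lemma hasWirtBarAt_conj_sub (z w : ℂ) : HasWirtBarAt (fun w => conj w - conj z) 1 w := by
  simpa using (HasWirtBarAt.conj_id w).sub (HasWirtBarAt.const (conj z) w)

lemma hasWirtBarAt_regDen (c : ℝ) (z w : ℂ) :
    HasWirtBarAt (regDen c z) ((c : ℂ) ^ 2 * (w - z)) w := by
  have h1 : HasWirtBarAt (fun w => w - z) 0 w :=
    HasWirtBarAt.of_hasDerivAt ((hasDerivAt_id w).sub_const z)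
  have h := ((h1.mul (hasWirtBarAt_conj_sub z w)).const_mul ((c : ℂ) ^ 2)).add
    (HasWirtBarAt.const 1 w)
  rw [zero_mul, zero_add, mul_one, add_zero] at h
  exact h

lemma hasWirtBarAt_regDen_inv (c : ℝ) (z w : ℂ) :
    HasWirtBarAt (fun w => (regDen c z w)⁻¹)
      (-(regDen c z w ^ 2)⁻¹ * ((c : ℂ) ^ 2 * (w - z))) w :=
  HasWirtBarAt.comp (h := fun x => x⁻¹) (hasDerivAt_inv (regDen_ne_zero c z w))
    (hasWirtBarAt_regDen c z w)

lemma hasWirtBarAt_regSol (c : ℝ) (z w : ℂ) :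
    HasWirtBarAt (regSol c z) (regSol₁ c z w) w := by
  have h := (((hasWirtBarAt_conj_sub z w).mul (hasWirtBarAt_conj_sub z w)).const_mul
    ((c : ℂ) ^ 2)).mul (hasWirtBarAt_regDen_inv c z w)
  refine ⟨h.1, h.2.trans ?_⟩
  have hs := regDen_ne_zero c z w
  rw [regSol₁]
  field_simp
  rw [regDen]
  ring

/-- This is `∂̄²` of the regularization: the peak `2/(1+|x|²)³` rescaled by `c`, hence an
approximate identity as `c → ∞`. -/
lemma hasWirtBarAt_regSol₁ (c : ℝ) (z w : ℂ) :
    HasWirtBarAt (regSol₁ c z) (2 * (c : ℂ) ^ 2 / regDen c z w ^ 3) w := by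
  have hi := hasWirtBarAt_regDen_inv c z w
  have h := (((hasWirtBarAt_conj_sub z w).mul ((hasWirtBarAt_regDen c z w).add
    (HasWirtBarAt.const 1 w))).const_mul ((c : ℂ) ^ 2)).mul (hi.mul hi)
  refine ⟨h.1, h.2.trans ?_⟩
  have hs := regDen_ne_zero c z w
  field_simp
  rw [regDen]
  ring

lemma contDiff_regDen (c : ℝ) (z : ℂ) {n : WithTop ℕ∞} : ContDiff ℝ n (regDen c z) := by
  have hc : ContDiff ℝ n fun w : ℂ => conj w := Complex.conjCLE.contDiff
  exact (contDiff_const.mul ((contDiff_id.sub contDiff_const).mul (hc.sub contDiff_const))).add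
    contDiff_const

lemma contDiff_regSol (c : ℝ) (z : ℂ) {n : WithTop ℕ∞} : ContDiff ℝ n (regSol c z) := by
  have hc : ContDiff ℝ n fun w : ℂ => conj w - conj z :=
    Complex.conjCLE.contDiff.sub contDiff_const
  exact (contDiff_const.mul (hc.mul hc)).mul ((contDiff_regDen c z).inv (regDen_ne_zero c z))

lemma continuous_regSol₁ (c : ℝ) (z : ℂ) : Continuous (regSol₁ c z) := by
  have hd : Continuous (regDen c z) := (contDiff_regDen c z (n := 0)).continuous
  have hi := hd.inv₀ (regDen_ne_zero c z)
  have hc : Continuous fun w : ℂ => conj w - conj z :=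
    Complex.continuous_conj.sub continuous_const
  exact (continuous_const.mul (hc.mul (hd.add continuous_const))).mul (hi.mul hi)

lemma norm_regDen (c : ℝ) (z w : ℂ) : ‖regDen c z w‖ = c ^ 2 * ‖w - z‖ ^ 2 + 1 := by
  rw [regDen_eq, Complex.norm_real, Real.norm_of_nonneg (by positivity)]

lemma norm_conj_sub (z w : ℂ) : ‖conj w - conj z‖ = ‖w - z‖ := by
  rw [← map_sub, RCLike.norm_conj]

lemma norm_regSol_le (c : ℝ) (z w : ℂ) : ‖regSol c z w‖ ≤ 1 := by
  rw [regSol, norm_mul, norm_inv, norm_regDen, norm_mul, norm_mul, norm_conj_sub, norm_pow,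
    Complex.norm_real, Real.norm_eq_abs, sq_abs, ← div_eq_mul_inv, div_le_one (by positivity)]
  nlinarith

/-- With `t = c²|w-z|²` the bound is `t(t+2)/(t+1)² ≤ 1`. Its uniformity in `c` serves the dominated
convergence as `c → ∞`. -/
lemma norm_regSol₁_mul_le (c : ℝ) (z w : ℂ) : ‖regSol₁ c z w‖ * ‖w - z‖ ≤ 1 := by
  have h1 : ‖regDen c z w + 1‖ ≤ c ^ 2 * ‖w - z‖ ^ 2 + 1 + 1 :=
    (norm_add_le _ _).trans (by rw [norm_regDen, norm_one])
  rw [regSol₁, norm_mul, norm_mul, norm_mul, norm_mul, norm_inv, norm_conj_sub, norm_pow,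
    Complex.norm_real, Real.norm_eq_abs, sq_abs]
  have hs : 0 < c ^ 2 * ‖w - z‖ ^ 2 + 1 := by positivity
  rw [norm_regDen]
  calc _ ≤ c ^ 2 * (‖w - z‖ * (c ^ 2 * ‖w - z‖ ^ 2 + 1 + 1))
        * ((c ^ 2 * ‖w - z‖ ^ 2 + 1)⁻¹ * (c ^ 2 * ‖w - z‖ ^ 2 + 1)⁻¹) * ‖w - z‖ := by gcongr
    _ = (c ^ 2 * ‖w - z‖ ^ 2 * (c ^ 2 * ‖w - z‖ ^ 2 + 1 + 1)) / (c ^ 2 * ‖w - z‖ ^ 2 + 1) ^ 2 := by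
      field_simp
    _ ≤ 1 := by
      rw [div_le_one (by positivity)]
      nlinarith

lemma tendsto_regSol {z w : ℂ} (h : w ≠ z) :
    Tendsto (fun c : ℝ => regSol c z w) atTop (𝓝 ((conj w - conj z) / (w - z))) := by
  have h1 : w - z ≠ 0 := sub_ne_zero.2 h
  have h2 : conj w - conj z ≠ 0 := by
    rwa [← norm_ne_zero_iff, norm_conj_sub, norm_ne_zero_iff]
  have ht : Tendsto (fun c : ℝ => ((c⁻¹ : ℝ) : ℂ)) atTop (𝓝 0) := by
    have := (Complex.continuous_ofReal.tendsto 0).comp tendsto_inv_atTop_zero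
    rwa [Complex.ofReal_zero] at this
  -- In terms of `t = 1/c` the regularization extends continuously to `t = 0`.
  have hc : ContinuousAt (fun t : ℂ => (conj w - conj z) ^ 2
      / ((w - z) * (conj w - conj z) + t ^ 2)) 0 := by
    refine ContinuousAt.div (by fun_prop) (by fun_prop) ?_
    simp [h1, h2]
  have := hc.tendsto.comp ht
  have e : (conj w - conj z) ^ 2 / ((w - z) * (conj w - conj z) + 0 ^ 2)
      = (conj w - conj z) / (w - z) := by
    field_simp
    simp
  rw [e] at this
  refine this.congr' ?_
  filter_upwards [eventually_gt_atTop 0] with c hc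
  have hc' : (c : ℂ) ≠ 0 := by exact_mod_cast hc.ne'
  have hs := regDen_ne_zero c z w
  have e2 : (w - z) * (conj w - conj z) + ((c⁻¹ : ℝ) : ℂ) ^ 2 = regDen c z w / (c : ℂ) ^ 2 := by
    rw [regDen]
    push_cast
    field_simp
  simp only [Function.comp_apply]
  rw [e2, regSol]
  field_simp

lemma tendsto_regSol₁ {z w : ℂ} (h : w ≠ z) :
    Tendsto (fun c : ℝ => regSol₁ c z w) atTop (𝓝 (1 / (w - z))) := by
  have h1 : w - z ≠ 0 := sub_ne_zero.2 h
  have h2 : conj w - conj z ≠ 0 := by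
    rwa [← norm_ne_zero_iff, norm_conj_sub, norm_ne_zero_iff]
  have ht : Tendsto (fun c : ℝ => ((c⁻¹ : ℝ) : ℂ)) atTop (𝓝 0) := by
    have := (Complex.continuous_ofReal.tendsto 0).comp tendsto_inv_atTop_zero
    rwa [Complex.ofReal_zero] at this
  have hc : ContinuousAt (fun t : ℂ => (conj w - conj z)
      * ((w - z) * (conj w - conj z) + 2 * t ^ 2)
      / ((w - z) * (conj w - conj z) + t ^ 2) ^ 2) 0 := by
    refine ContinuousAt.div (by fun_prop) (by fun_prop) ?_
    simp [h1, h2]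
  have := hc.tendsto.comp ht
  have e : (conj w - conj z) * ((w - z) * (conj w - conj z) + 2 * 0 ^ 2)
      / ((w - z) * (conj w - conj z) + 0 ^ 2) ^ 2 = 1 / (w - z) := by
    field_simp
    simp
    ring
  rw [e] at this
  refine this.congr' ?_
  filter_upwards [eventually_gt_atTop 0] with c hc
  have hc' : (c : ℂ) ≠ 0 := by exact_mod_cast hc.ne'
  have hs := regDen_ne_zero c z w
  have e2 : (w - z) * (conj w - conj z) + ((c⁻¹ : ℝ) : ℂ) ^ 2 = regDen c z w / (c : ℂ) ^ 2 := by
    rw [regDen]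
    push_cast
    field_simp
  have e3 : (w - z) * (conj w - conj z) + 2 * ((c⁻¹ : ℝ) : ℂ) ^ 2
      = (regDen c z w + 1) / (c : ℂ) ^ 2 := by
    rw [regDen]
    push_cast
    field_simp
    ring
  simp only [Function.comp_apply]
  rw [e2, e3, regSol₁]
  field_simp

/-! ### The approximate identity -/

lemma areaMeasure_real_ball : areaMeasure.real (ball (0 : ℂ) 1) = 1 := by
  rw [areaMeasure, measureReal_def, Measure.smul_apply, Complex.volume_ball]
  simp [Real.pi_pos.le, Real.pi_ne_zero]

/-- In polar coordinates: the dimension 2, times the area 1 of the unit disk for `dA`, times the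
radial integral 1/2. -/
lemma integral_peak : ∫ x : ℂ, 2 / (1 + ‖x‖ ^ 2) ^ 3 ∂areaMeasure = 1 := by
  rw [integral_fun_norm_addHaar areaMeasure fun t : ℝ => 2 / (1 + t ^ 2) ^ 3]
  rw [areaMeasure_real_ball, Complex.finrank_real_complex]
  have hderiv : ∀ x : ℝ, HasDerivAt (fun t : ℝ => -(1 / 2) * ((1 + t ^ 2) ^ 2)⁻¹)
      (x * (2 / (1 + x ^ 2) ^ 3)) x := by
    intro x
    have hx : (1 + x ^ 2) ≠ 0 := by positivity
    have h := ((((hasDerivAt_pow 2 x).const_add 1).fun_pow 2).fun_inv (by positivity)).const_mul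
      (-(1 / 2) : ℝ)
    refine h.congr_deriv ?_
    norm_num
    field_simp
  have hlim : Tendsto (fun t : ℝ => -(1 / 2) * ((1 + t ^ 2) ^ 2)⁻¹) atTop (𝓝 (-(1 / 2) * 0)) := by
    refine Tendsto.const_mul _ (tendsto_inv_atTop_zero.comp ?_)
    refine (tendsto_pow_atTop two_ne_zero).comp ?_
    exact tendsto_atTop_add_const_left _ _ (tendsto_pow_atTop two_ne_zero)
  have h := integral_Ioi_of_hasDerivAt_of_nonneg' (a := 0) (fun x _ => hderiv x)
    (fun x hx => by
      have : (0 : ℝ) < x := hx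
      positivity) hlim
  have e : ∫ y in Ioi (0 : ℝ), y ^ (2 - 1) • (2 / (1 + y ^ 2) ^ 3) = 1 / 2 := by
    simp only [smul_eq_mul]
    norm_num
    norm_num at h
    exact h
  rw [e]
  norm_num

lemma tendsto_peak :
    Tendsto (fun x : ℂ => ‖x‖ ^ Module.finrank ℝ ℂ * (2 / (1 + ‖x‖ ^ 2) ^ 3))
      (Bornology.cobounded ℂ) (𝓝 0) := by
  rw [Complex.finrank_real_complex]
  have hlim : Tendsto (fun t : ℝ => 2 * (1 + t ^ 2)⁻¹) atTop (𝓝 0) := by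
    have : Tendsto (fun t : ℝ => (1 + t ^ 2)⁻¹) atTop (𝓝 0) := tendsto_inv_atTop_zero.comp
      (tendsto_atTop_add_const_left _ _ (tendsto_pow_atTop two_ne_zero))
    simpa using this.const_mul 2
  refine squeeze_zero (fun x => by positivity) (fun x => ?_)
    (hlim.comp tendsto_norm_cobounded_atTop)
  simp only [Function.comp_apply]
  rw [mul_div_assoc', ← div_eq_mul_inv, div_le_div_iff₀ (by positivity) (by positivity)]
  have h : 0 ≤ ‖x‖ ^ 2 := by positivity
  set t := ‖x‖ ^ 2
  nlinarith [mul_nonneg h h, mul_nonneg (mul_nonneg h h) h]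

/-- The Cauchy-Pompeiu formula for `∂̄²`, for functions that are bianalytic in the weak sense. -/
lemma bianalytic_representation {u G : ℂ → ℂ} (hu : IsPolyanalyticOn 2 u univ)
    (hG : ContDiff ℝ ((⊤ : ℕ∞) : WithTop ℕ∞) G) (hGc : HasCompactSupport G) {z : ℂ}
    (hz : wirtBar G z = 0) :
    u z * G z = -∫ w, u w * (2 * wirtBar G w / (w - z)
      + (conj w - conj z) / (w - z) * wirtBar (wirtBar G) w) ∂areaMeasure := by
  have huc : Continuous u := continuousOn_univ.1 hu.1
  have hG1 := contDiff_wirtBar hG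
  have hG2 := contDiff_wirtBar hG1
  have hG1c := hasCompactSupport_wirtBar hGc
  have hG2c := hasCompactSupport_wirtBar hG1c
  -- Since `∂̄G(z) = 0`, the Lipschitz bound gives `|∂̄G(w)| ≤ L|w-z|`, which compensates the
  -- singularity `1/(w-z)`.
  obtain ⟨L, hL⟩ := hG1.lipschitzWith_of_hasCompactSupport hG1c (by simp)
  have hL' : ∀ w, ‖wirtBar G w‖ ≤ L * ‖w - z‖ := fun w => by
    have := hL.dist_le_mul w z
    rwa [hz, dist_zero_right, dist_eq_norm] at this
  -- The weak equation for `u` is tested against the smooth function `G · regSol`; Leibniz separates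
  -- the peak, which tends to evaluation at `z`, from the terms that survive in the formula.
  have hzero : ∀ c : ℝ, ∫ w, u w * (G w * (2 * (c : ℂ) ^ 2 / regDen c z w ^ 3)) ∂areaMeasure
      + ∫ w, u w * (2 * wirtBar G w * regSol₁ c z w
        + wirtBar (wirtBar G) w * regSol c z w) ∂areaMeasure = 0 := by
    intro c
    have htest : IsTest univ fun w => G w * regSol c z w :=
      ⟨hG.mul (contDiff_regSol c z), hGc.mul_right, subset_univ _⟩
    have h := hu.2 _ htest
    change ∫ w, u w * wirtBar (wirtBar fun w => G w * regSol c z w) w ∂_ = 0 at h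
    have e1 : wirtBar (fun w => G w * regSol c z w)
        = fun w => wirtBar G w * regSol c z w + G w * regSol₁ c z w :=
      funext fun w => ((HasWirtBarAt.of_contDiff hG w).mul (hasWirtBarAt_regSol c z w)).2
    have e2 : ∀ w, wirtBar (wirtBar fun w => G w * regSol c z w) w
        = G w * (2 * (c : ℂ) ^ 2 / regDen c z w ^ 3) + (2 * wirtBar G w * regSol₁ c z w
          + wirtBar (wirtBar G) w * regSol c z w) := by
      intro w
      rw [e1, (((HasWirtBarAt.of_contDiff hG1 w).mul (hasWirtBarAt_regSol c z w)).add
        ((HasWirtBarAt.of_contDiff hG w).mul (hasWirtBarAt_regSol₁ c z w))).2]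
      ring
    simp_rw [e2, mul_add] at h
    have hd : Continuous (regDen c z) := (contDiff_regDen c z (n := 0)).continuous
    simp_rw [mul_add]
    rw [← integral_add, h]
    · exact (huc.mul (hG.continuous.mul (continuous_const.div (hd.pow 3)
        fun w => pow_ne_zero 3 (regDen_ne_zero c z w)))).integrable_of_hasCompactSupport
        hGc.mul_right.mul_left
    · refine ((huc.mul ((continuous_const.mul hG1.continuous).mul (continuous_regSol₁ c z))).add
        (huc.mul (hG2.continuous.mul (contDiff_regSol c z
          (n := 0)).continuous))).integrable_of_hasCompactSupport ?_
      exact HasCompactSupport.add (hG1c.mul_left.mul_right.mul_left) (hG2c.mul_right.mul_left)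
  have hlim1 : Tendsto (fun c : ℝ =>
      ∫ w, u w * (G w * (2 * (c : ℂ) ^ 2 / regDen c z w ^ 3)) ∂areaMeasure) atTop
      (𝓝 (u z * G z)) := by
    have h := tendsto_integral_comp_smul_smul_of_integrable' (μ := areaMeasure)
      (φ := fun x : ℂ => 2 / (1 + ‖x‖ ^ 2) ^ 3) (fun x => by positivity) integral_peak
      tendsto_peak (g := fun w => u w * G w) (x₀ := z)
      ((huc.mul hG.continuous).integrable_of_hasCompactSupport hGc.mul_left)
      (huc.mul hG.continuous).continuousAt
    refine h.congr fun c => ?_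
    congr 1
    ext w
    rw [regDen_eq, Complex.finrank_real_complex, norm_smul, norm_sub_rev, mul_pow,
      Real.norm_eq_abs, sq_abs, Complex.real_smul]
    push_cast
    ring
  have hlim2 : Tendsto (fun c : ℝ => ∫ w, u w * (2 * wirtBar G w * regSol₁ c z w
        + wirtBar (wirtBar G) w * regSol c z w) ∂areaMeasure) atTop
      (𝓝 (∫ w, u w * (2 * wirtBar G w / (w - z)
      + (conj w - conj z) / (w - z) * wirtBar (wirtBar G) w) ∂areaMeasure)) := by
    refine tendsto_integral_filter_of_dominated_convergence
      ((tsupport G).indicator fun w => ‖u w‖ * (2 * L + ‖wirtBar (wirtBar G) w‖)) ?_ ?_ ?_ ?_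
    · refine Eventually.of_forall fun c => Continuous.aestronglyMeasurable ?_
      exact huc.mul (((continuous_const.mul hG1.continuous).mul (continuous_regSol₁ c z)).add
        (hG2.continuous.mul (contDiff_regSol c z (n := 0)).continuous))
    · refine Eventually.of_forall fun c => Eventually.of_forall fun w => ?_
      by_cases hw : w ∈ tsupport G
      · rw [indicator_of_mem hw, norm_mul]
        gcongr
        refine (norm_add_le _ _).trans (add_le_add ?_ ?_)
        · rw [norm_mul, norm_mul, Complex.norm_ofNat]
          have h1 := hL' w
          have h2 := norm_regSol₁_mul_le c z w
          calc 2 * ‖wirtBar G w‖ * ‖regSol₁ c z w‖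
              ≤ 2 * (L * ‖w - z‖) * ‖regSol₁ c z w‖ := by gcongr
            _ = 2 * L * (‖regSol₁ c z w‖ * ‖w - z‖) := by ring
            _ ≤ 2 * L * 1 := by gcongr
            _ = 2 * L := mul_one _
        · rw [norm_mul]
          exact mul_le_of_le_one_right (norm_nonneg _) (norm_regSol_le c z w)
      · have h1 : wirtBar G w = 0 :=
          image_eq_zero_of_notMem_tsupport fun h => hw (tsupport_wirtBar_subset G h)
        have h2 : wirtBar (wirtBar G) w = 0 := image_eq_zero_of_notMem_tsupport fun h =>
          hw (tsupport_wirtBar_subset G (tsupport_wirtBar_subset _ h))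
        rw [indicator_of_notMem hw, h1, h2]
        simp
    · rw [integrable_indicator_iff (isClosed_tsupport G).measurableSet]
      exact (huc.norm.mul (continuous_const.add hG2.continuous.norm)).continuousOn.integrableOn_compact
        hGc
    · have : ∀ᵐ w ∂areaMeasure, w ≠ z := by
        rw [ae_iff]
        simp
      filter_upwards [this] with w hw
      have h1 := (tendsto_regSol₁ hw).const_mul (2 * wirtBar G w)
      have h2 := (tendsto_regSol hw).const_mul (wirtBar (wirtBar G) w)
      have h3 := (h1.add h2).const_mul (u w)
      convert h3 using 2
      ring
  have h := tendsto_nhds_unique (hlim1.add hlim2) (tendsto_const_nhds.congr fun c => (hzero c).symm)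
  exact eq_neg_of_add_eq_zero_left h

/-! ### Bounded families -/

/-- The function `f` is bounded on `S`. -/
def BddOn (S : Set (ℂ × ℂ)) (f : ℂ × ℂ → ℂ) : Prop := ∃ C : ℝ, ∀ p ∈ S, ‖f p‖ ≤ C

namespace BddOn

variable {S : Set (ℂ × ℂ)} {f g : ℂ × ℂ → ℂ}

lemma add (hf : BddOn S f) (hg : BddOn S g) : BddOn S fun p => f p + g p := by
  obtain ⟨C, hC⟩ := hf
  obtain ⟨D, hD⟩ := hg
  exact ⟨C + D, fun p hp => (norm_add_le _ _).trans (add_le_add (hC p hp) (hD p hp))⟩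

lemma neg (hf : BddOn S f) : BddOn S fun p => -f p := by
  obtain ⟨C, hC⟩ := hf
  exact ⟨C, fun p hp => by rw [norm_neg]; exact hC p hp⟩

lemma sub (hf : BddOn S f) (hg : BddOn S g) : BddOn S fun p => f p - g p := by
  simpa only [sub_eq_add_neg] using hf.add hg.neg

lemma mul (hf : BddOn S f) (hg : BddOn S g) : BddOn S fun p => f p * g p := by
  obtain ⟨C, hC⟩ := hf
  obtain ⟨D, hD⟩ := hg
  refine ⟨C * D, fun p hp => ?_⟩
  rw [norm_mul]
  exact mul_le_mul (hC p hp) (hD p hp) (norm_nonneg _) ((norm_nonneg _).trans (hC p hp))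

lemma const (S : Set (ℂ × ℂ)) (c : ℂ) : BddOn S fun _ => c := ⟨‖c‖, fun _ _ => le_rfl⟩

lemma of_continuousOn (hS : IsCompact S) (hf : ContinuousOn f S) : BddOn S f :=
  hS.exists_bound_of_continuousOn hf

/-- If `‖f‖ ≤ M ‖g‖`, then `f / g` is bounded. -/
lemma div_of_le {M : ℝ} (h : ∀ p ∈ S, ‖f p‖ ≤ M * ‖g p‖) (hM : 0 ≤ M) :
    BddOn S fun p => f p / g p := by
  refine ⟨M, fun p hp => ?_⟩
  rw [norm_div]
  exact div_le_of_le_mul₀ (norm_nonneg _) hM (h p hp)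

end BddOn

/-! ### Taylor estimates -/

lemma norm_sub_le_of_hasDerivAt {s : Set ℂ} (hs : Convex ℝ s) {f f₁ : ℂ → ℂ}
    (h0 : ∀ x ∈ s, HasDerivAt f (f₁ x) x) {M : ℝ} (hM : ∀ x ∈ s, ‖f₁ x‖ ≤ M) {z w : ℂ}
    (hz : z ∈ s) (hw : w ∈ s) : ‖f w - f z‖ ≤ M * ‖w - z‖ :=
  hs.norm_image_sub_le_of_norm_hasDerivWithin_le (fun x hx => (h0 x hx).hasDerivWithinAt) hM hz hw

/-- Intersecting the convex set with the closed disk of radius `|w-z|` about `z` replaces the bound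
`M|x-z|` on the derivative by the constant `M|w-z|`. The factorial is lost, which is harmless here.
-/
lemma norm_taylor_two_le {s : Set ℂ} (hs : Convex ℝ s) {f f₁ f₂ : ℂ → ℂ}
    (h0 : ∀ x ∈ s, HasDerivAt f (f₁ x) x) (h1 : ∀ x ∈ s, HasDerivAt f₁ (f₂ x) x) {M : ℝ}
    (hM : ∀ x ∈ s, ‖f₂ x‖ ≤ M) {z w : ℂ} (hz : z ∈ s) (hw : w ∈ s) :
    ‖f w - f z - (w - z) * f₁ z‖ ≤ M * ‖w - z‖ ^ 2 := by
  have hM0 : 0 ≤ M := (norm_nonneg _).trans (hM z hz)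
  have h := norm_sub_le_of_hasDerivAt (hs.inter (convex_closedBall z ‖w - z‖))
    (f := fun x => f x - (x - z) * f₁ z) (f₁ := fun x => f₁ x - 1 * f₁ z)
    (fun x hx => (h0 x hx.1).sub (((hasDerivAt_id x).sub_const z).mul_const _))
    (M := M * ‖w - z‖) (fun x hx => by
      rw [one_mul]
      refine (norm_sub_le_of_hasDerivAt hs h1 hM hz hx.1).trans ?_
      have := hx.2
      rw [mem_closedBall, dist_eq_norm] at this
      gcongr) (z := z) (w := w) ⟨hz, mem_closedBall_self (norm_nonneg _)⟩
    ⟨hw, by rw [mem_closedBall, dist_eq_norm]⟩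
  calc ‖f w - f z - (w - z) * f₁ z‖ = ‖f w - (w - z) * f₁ z - (f z - (z - z) * f₁ z)‖ := by
        congr 1
        ring
    _ ≤ M * ‖w - z‖ * ‖w - z‖ := h
    _ = M * ‖w - z‖ ^ 2 := by ring

lemma norm_taylor_three_le {s : Set ℂ} (hs : Convex ℝ s) {f f₁ f₂ f₃ : ℂ → ℂ}
    (h0 : ∀ x ∈ s, HasDerivAt f (f₁ x) x) (h1 : ∀ x ∈ s, HasDerivAt f₁ (f₂ x) x)
    (h2 : ∀ x ∈ s, HasDerivAt f₂ (f₃ x) x) {M : ℝ}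
    (hM : ∀ x ∈ s, ‖f₃ x‖ ≤ M) {z w : ℂ} (hz : z ∈ s) (hw : w ∈ s) :
    ‖f w - f z - (w - z) * f₁ z - (w - z) ^ 2 / 2 * f₂ z‖ ≤ M * ‖w - z‖ ^ 3 := by
  have hM0 : 0 ≤ M := (norm_nonneg _).trans (hM z hz)
  have h := norm_sub_le_of_hasDerivAt (hs.inter (convex_closedBall z ‖w - z‖))
    (f := fun x => f x - (x - z) * f₁ z - (x - z) ^ 2 / 2 * f₂ z)
    (f₁ := fun x => f₁ x - f₁ z - (x - z) * f₂ z)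
    (fun x hx => by
      have hd := (hasDerivAt_id x).sub_const z
      refine (((h0 x hx.1).sub (hd.mul_const (f₁ z))).sub
        (((hd.fun_pow 2).div_const 2).mul_const (f₂ z))).congr_deriv ?_
      simp)
    (M := M * ‖w - z‖ ^ 2) (fun x hx => by
      refine (norm_taylor_two_le hs h1 h2 hM hz hx.1).trans ?_
      have := hx.2
      rw [mem_closedBall, dist_eq_norm] at this
      gcongr) (z := z) (w := w) ⟨hz, mem_closedBall_self (norm_nonneg _)⟩
    ⟨hw, by rw [mem_closedBall, dist_eq_norm]⟩
  calc ‖f w - f z - (w - z) * f₁ z - (w - z) ^ 2 / 2 * f₂ z‖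
      = ‖f w - (w - z) * f₁ z - (w - z) ^ 2 / 2 * f₂ z
        - (f z - (z - z) * f₁ z - (z - z) ^ 2 / 2 * f₂ z)‖ := by
        congr 1
        ring
    _ ≤ M * ‖w - z‖ ^ 2 * ‖w - z‖ := h
    _ = M * ‖w - z‖ ^ 3 := by ring

/-! ### Comparison of the amplitudes -/

lemma SepHol.div {F G : ℂ → ℂ → ℂ} {U V : Set ℂ} (hF : SepHol F U V) (hG : SepHol G U V)
    (h : ∀ z ∈ U, ∀ v ∈ V, G z v ≠ 0) : SepHol (fun z v => F z v / G z v) U V :=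
  ⟨fun v hv => (hF.fst v hv).div (hG.fst v hv) fun z hz => h z hz v hv,
    fun z hz => (hF.snd z hz).div (hG.snd z hz) fun v hv => h z hz v hv,
    hF.cont.div hG.cont fun x hx => h x.1 hx.1 x.2 hx.2⟩

lemma conj_mem_closedBall {z c : ℂ} {r : ℝ} :
    conj z ∈ closedBall (conj c) r ↔ z ∈ closedBall c r := by
  simp only [mem_closedBall, dist_eq_norm, ← map_sub, RCLike.norm_conj]

lemma SepHol.exists_bound {F : ℂ → ℂ → ℂ} {c : ℂ} {r ρ : ℝ}
    (h : SepHol F (ball c r) (ball (conj c) r)) (hρ : ρ < r) :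
    ∃ M : ℝ, 0 ≤ M ∧ ∀ z ∈ closedBall c ρ, ∀ v ∈ closedBall (conj c) ρ, ‖F z v‖ ≤ M := by
  obtain ⟨M, hM⟩ := ((isCompact_closedBall c ρ).prod
    (isCompact_closedBall (conj c) ρ)).exists_bound_of_continuousOn
    (h.cont.mono (prod_mono (closedBall_subset_ball hρ) (closedBall_subset_ball hρ)))
  exact ⟨max M 0, le_max_right _ _, fun z hz v hv => (hM (z, v) ⟨hz, hv⟩).trans (le_max_left _ _)⟩

lemma SepHol.bddOn {F : ℂ → ℂ → ℂ} {c : ℂ} {r ρ : ℝ}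
    (h : SepHol F (ball c r) (ball (conj c) r)) (hρ : ρ < r) {f g : ℂ × ℂ → ℂ}
    {S : Set (ℂ × ℂ)} (hf : ∀ p ∈ S, f p ∈ closedBall c ρ) (hg : ∀ p ∈ S, g p ∈ closedBall c ρ) :
    BddOn S fun p => F (f p) (conj (g p)) := by
  obtain ⟨M, -, hM⟩ := h.exists_bound hρ
  exact ⟨M, fun p hp => hM _ (hf p hp) _ (conj_mem_closedBall.2 (hg p hp))⟩

/-- The difference `∂̄_w P(w, w) - ∂̄_w P(z, w)`, which is `-∂̄_w (P(z, w) - Q(w))`. -/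
def phaseBar (P : ℂ → ℂ → ℂ) (z w : ℂ) : ℂ :=
  D2 (polar P) w (conj w) - D2 (polar P) z (conj w)

/-- The `∂̄_w`-derivative of `phaseBar`. -/
def phaseBar₁ (P : ℂ → ℂ → ℂ) (z w : ℂ) : ℂ :=
  D2 (D2 (polar P)) w (conj w) - D2 (D2 (polar P)) z (conj w)

/-- The logarithmic derivative `∂_z b / b`. -/
def logDerivB (P : ℂ → ℂ → ℂ) (z v : ℂ) : ℂ := D1 (bHol P) z v / bHol P z v

/-- The amplitude of the kernel obtained by integration by parts from the phase function. -/
def phaseAmp (P : ℂ → ℂ → ℂ) (m : ℝ) (z w : ℂ) : ℂ :=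
  (1 - logDerivB P z (conj z) * (w - z)) *
    (2 * m * phaseBar P z w / (w - z)
      + m * ((conj w - conj z) / (w - z)) * phaseBar₁ P z w
      - (m : ℂ) ^ 2 * ((conj w - conj z) / (w - z)) * phaseBar P z w ^ 2)

/-- The algebraic identity behind the comparison of the two amplitudes: `α`, `β` and `γ` are the
normalized Taylor remainders. -/
lemma amplitude_identity {ζ W a a' b b₁ b₂ k c m α β γ : ℂ} (hζ : ζ ≠ 0)
    (ha : a = ζ * b + ζ ^ 2 / 2 * b₁ + ζ ^ 3 * α) (ha' : a' = ζ * b₂ + ζ ^ 2 * β)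
    (hc : c * b = b₁ + ζ * γ) :
    (1 - c * ζ) * (2 * m * a / ζ + m * (W / ζ) * a' - m ^ 2 * (W / ζ) * a ^ 2)
      - (m ^ 2 * (-(-ζ * -W) * b ^ 2) + m * (2 * b + -ζ * b₁ - -W * b₂ + -ζ * -W * k))
    = m * ζ ^ 2 * (-2 * γ - c * b₁ + (1 - c * ζ) * (2 * α + W / ζ * β) - c * (W / ζ) * b₂
        - W / ζ * k)
      + m ^ 2 * ζ ^ 4 * (-(W / ζ) * (2 * b * α + (b₁ / 2 + ζ * α) * (b₁ / 2 + ζ * α) - b * γ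
        - c * (2 * b * (b₁ / 2 + ζ * α) + ζ * ((b₁ / 2 + ζ * α) * (b₁ / 2 + ζ * α))))) := by
  obtain ⟨ω, rfl⟩ : ∃ ω, W = ζ * ω := ⟨W / ζ, by field_simp⟩
  have e : ζ * ω / ζ = ω := by field_simp
  have e2 : 2 * m * a / ζ = 2 * m * (b + ζ / 2 * b₁ + ζ ^ 2 * α) := by
    rw [ha]
    field_simp
  rw [e, e2, ha', ha]
  -- The two multipliers are the two cancellations due to `c`: the mismatch `2mζ(b₁ - cb)` in the
  -- `m`-terms and `m²ωζ³b(cb - b₁)` in the `m²`-terms.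
  linear_combination (-2 * ζ * m + m ^ 2 * ω * ζ ^ 3 * b) * hc

/-- Taylor expansion in the first variable from `z` to `w`, with the second variable frozen at `w̄`.
The normalized remainders `α`, `β`, `γ` are bounded on a compact bidisk off the diagonal, and so are
the cofactors in `amplitude_identity`. -/
lemma IsAdmissible.amplitude_bound {Q : ℂ → ℝ} (hQ : Continuous Q) {P : ℂ → ℂ → ℂ} {z₀ : ℂ}
    {r ρ : ℝ} (h : IsAdmissible Q P z₀ r) (hρ : ρ < r) :
    ∃ C : ℝ, 0 ≤ C ∧ ∀ m : ℝ, 0 ≤ m → ∀ z ∈ closedBall z₀ ρ, ∀ w ∈ closedBall z₀ ρ, w ≠ z →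
      ‖phaseAmp P m z w - amp P m z (conj z) w (conj w)‖
        ≤ C * (m * ‖w - z‖ ^ 2 + (m * ‖w - z‖ ^ 2) ^ 2) := by
  have hH := h.sepHol hQ
  have hb := sepHol_bHol hH
  have hb1 := hb.D1 isOpen_ball isOpen_ball
  have hb11 := hb1.D1 isOpen_ball isOpen_ball
  have hb2 := hb.D2 isOpen_ball isOpen_ball
  have hb12 := hb1.D2 isOpen_ball isOpen_ball
  have hp := hH.D2 isOpen_ball isOpen_ball
  have hq := hp.D2 isOpen_ball isOpen_ball
  have hq1 := hq.D1 isOpen_ball isOpen_ball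
  have hq11 := hq1.D1 isOpen_ball isOpen_ball
  have hl : SepHol (logDerivB P) (ball z₀ r) (ball (conj z₀) r) :=
    hb1.div hb fun z hz v hv => h.bHol_ne hQ hz hv
  have hl2 := hl.D2 isOpen_ball isOpen_ball
  set S : Set (ℂ × ℂ) := {p | p.1 ∈ closedBall z₀ ρ ∧ p.2 ∈ closedBall z₀ ρ ∧ p.2 ≠ p.1}
  have m1 : ∀ p ∈ S, p.1 ∈ closedBall z₀ ρ := fun p hp => hp.1
  have m2 : ∀ p ∈ S, p.2 ∈ closedBall z₀ ρ := fun p hp => hp.2.1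
  have hsub : closedBall z₀ ρ ⊆ ball z₀ r := closedBall_subset_ball hρ
  have hsub' : closedBall (conj z₀) ρ ⊆ ball (conj z₀) r := closedBall_subset_ball hρ
  have Bb := hb.bddOn hρ m1 m2
  have Bb1 := hb1.bddOn hρ m1 m2
  have Bb2 := hb2.bddOn hρ m1 m2
  have Bb12 := hb12.bddOn hρ m1 m2
  have Bl := hl.bddOn hρ m1 m2
  have Bc := hl.bddOn hρ m1 m1
  have Bζ : BddOn S fun p => p.2 - p.1 := by
    refine ⟨ρ + ρ, fun p hp => ?_⟩
    have h1 := m1 p hp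
    have h2 := m2 p hp
    rw [mem_closedBall] at h1 h2
    rw [← dist_eq_norm]
    linarith [dist_triangle_right p.2 p.1 z₀]
  have Bω : BddOn S fun p => (conj p.2 - conj p.1) / (p.2 - p.1) :=
    BddOn.div_of_le (M := 1) (fun p _ => by rw [norm_conj_sub, one_mul]) zero_le_one
  obtain ⟨M3, hM3, hM3'⟩ := hb11.exists_bound hρ
  have Bα : BddOn S fun p => (D2 (polar P) p.2 (conj p.2) - D2 (polar P) p.1 (conj p.2)
      - (p.2 - p.1) * bHol P p.1 (conj p.2)
      - (p.2 - p.1) ^ 2 / 2 * D1 (bHol P) p.1 (conj p.2)) / (p.2 - p.1) ^ 3 := by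
    refine BddOn.div_of_le (M := M3) (fun p hp' => ?_) hM3
    have hv := conj_mem_closedBall.2 (m2 p hp')
    rw [norm_pow]
    exact norm_taylor_three_le (convex_closedBall z₀ ρ)
      (f := fun x => D2 (polar P) x (conj p.2)) (f₁ := fun x => bHol P x (conj p.2))
      (f₂ := fun x => D1 (bHol P) x (conj p.2)) (f₃ := fun x => D1 (D1 (bHol P)) x (conj p.2))
      (fun x hx => hp.hasDerivAt_fst isOpen_ball (hsub hx) (hsub' hv))
      (fun x hx => hb.hasDerivAt_fst isOpen_ball (hsub hx) (hsub' hv))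
      (fun x hx => hb1.hasDerivAt_fst isOpen_ball (hsub hx) (hsub' hv))
      (fun x hx => hM3' x hx _ hv) (m1 p hp') (m2 p hp')
  obtain ⟨M2, hM2, hM2'⟩ := hq11.exists_bound hρ
  have Bβ : BddOn S fun p => (D2 (D2 (polar P)) p.2 (conj p.2) - D2 (D2 (polar P)) p.1 (conj p.2)
      - (p.2 - p.1) * D1 (D2 (D2 (polar P))) p.1 (conj p.2)) / (p.2 - p.1) ^ 2 := by
    refine BddOn.div_of_le (M := M2) (fun p hp' => ?_) hM2
    have hv := conj_mem_closedBall.2 (m2 p hp')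
    rw [norm_pow]
    exact norm_taylor_two_le (convex_closedBall z₀ ρ)
      (f := fun x => D2 (D2 (polar P)) x (conj p.2))
      (f₁ := fun x => D1 (D2 (D2 (polar P))) x (conj p.2))
      (f₂ := fun x => D1 (D1 (D2 (D2 (polar P)))) x (conj p.2))
      (fun x hx => hq.hasDerivAt_fst isOpen_ball (hsub hx) (hsub' hv))
      (fun x hx => hq1.hasDerivAt_fst isOpen_ball (hsub hx) (hsub' hv))
      (fun x hx => hM2' x hx _ hv) (m1 p hp') (m2 p hp')
  obtain ⟨M1, hM1, hM1'⟩ := hl2.exists_bound hρ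
  -- The constant `c` is taken at `z̄`, not `w̄`, so that `1 - c(w-z)` is holomorphic in `w`. The
  -- price is this remainder, of order `|w̄-z̄| = |w-z|`.
  have Bγ : BddOn S fun p => (logDerivB P p.1 (conj p.1) - logDerivB P p.1 (conj p.2))
      / (p.2 - p.1) := by
    refine BddOn.div_of_le (M := M1) (fun p hp' => ?_) hM1
    have h1 := norm_sub_le_of_hasDerivAt (convex_closedBall (conj z₀) ρ)
      (fun x hx => hl.hasDerivAt_snd isOpen_ball (hsub (m1 p hp')) (hsub' hx))
      (fun x hx => hM1' _ (m1 p hp') x hx) (conj_mem_closedBall.2 (m2 p hp'))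
      (conj_mem_closedBall.2 (m1 p hp'))
    rwa [norm_conj_sub, norm_sub_rev p.1 p.2] at h1
  have Bγ' := Bγ.mul Bb
  have Bk := ((BddOn.const S (-(3 / 2))).mul Bb12).add (Bl.mul Bb2)
  have Bη := (Bb1.mul (BddOn.const S (1 / 2))).add (Bζ.mul Bα)
  have BS1 := ((((BddOn.const S (-2)).mul Bγ').sub (Bc.mul Bb1)).add
    (((BddOn.const S 1).sub (Bc.mul Bζ)).mul
      (((BddOn.const S 2).mul Bα).add (Bω.mul Bβ)))).sub ((Bc.mul Bω).mul Bb2)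
    |>.sub (Bω.mul Bk)
  have BS2 := Bω.neg.mul ((((((BddOn.const S 2).mul Bb).mul Bα).add (Bη.mul Bη)).sub
    (Bb.mul Bγ')).sub (Bc.mul ((((BddOn.const S 2).mul Bb).mul Bη).add (Bζ.mul (Bη.mul Bη)))))
  obtain ⟨C1, hC1⟩ := BS1
  obtain ⟨C2, hC2⟩ := BS2
  refine ⟨max 0 (max C1 C2), le_max_left _ _, fun m hm z hz w hw hne => ?_⟩
  have hp' : (z, w) ∈ S := ⟨hz, hw, hne⟩
  have hζ : w - z ≠ 0 := sub_ne_zero.2 hne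
  have hbne : bHol P z (conj w) ≠ 0 :=
    h.bHol_ne hQ (hsub hz) (hsub' (conj_mem_closedBall.2 hw))
  -- Commuting derivatives identifies the linear coefficient of `phaseBar₁` with `∂̄_w b`, the
  -- coefficient in the kernel.
  have hcomm : D1 (D2 (D2 (polar P))) z (conj w) = D2 (bHol P) z (conj w) :=
    (hp.D2_D1 isOpen_ball isOpen_ball (hsub hz) (hsub' (conj_mem_closedBall.2 hw))).symm
  have key := amplitude_identity (ζ := w - z) (W := conj w - conj z) (m := (m : ℂ))
    (a := phaseBar P z w) (a' := phaseBar₁ P z w) (b := bHol P z (conj w))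
    (b₁ := D1 (bHol P) z (conj w)) (b₂ := D2 (bHol P) z (conj w))
    (k := -(3 / 2) * D2 (D1 (bHol P)) z (conj w) + logDerivB P z (conj w) * D2 (bHol P) z (conj w))
    (c := logDerivB P z (conj z))
    (α := (D2 (polar P) w (conj w) - D2 (polar P) z (conj w)
      - (w - z) * bHol P z (conj w)
      - (w - z) ^ 2 / 2 * D1 (bHol P) z (conj w)) / (w - z) ^ 3)
    (β := (D2 (D2 (polar P)) w (conj w) - D2 (D2 (polar P)) z (conj w)
      - (w - z) * D1 (D2 (D2 (polar P))) z (conj w)) / (w - z) ^ 2)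
    (γ := (logDerivB P z (conj z) - logDerivB P z (conj w)) / (w - z) * bHol P z (conj w)) hζ
    (by
      rw [phaseBar]
      field_simp
      ring)
    (by
      rw [phaseBar₁, hcomm]
      field_simp
      ring)
    (by
      have e : D1 (bHol P) z (conj w) = logDerivB P z (conj w) * bHol P z (conj w) := by
        rw [logDerivB]
        field_simp
      rw [e]
      field_simp
      ring)
  have hamp : amp P m z (conj z) w (conj w) = (m : ℂ) ^ 2 * (-(-(w - z) * -(conj w - conj z))
      * bHol P z (conj w) ^ 2) + m * (2 * bHol P z (conj w) + -(w - z) * D1 (bHol P) z (conj w)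
      - -(conj w - conj z) * D2 (bHol P) z (conj w) + -(w - z) * -(conj w - conj z)
        * (-(3 / 2) * D2 (D1 (bHol P)) z (conj w)
          + logDerivB P z (conj w) * D2 (bHol P) z (conj w))) := by
    rw [amp, logDerivB]
    ring
  rw [phaseAmp, hamp, key]
  have h1 := hC1 _ hp'
  have h2 := hC2 _ hp'
  simp only [mul_one_div] at h1 h2
  refine (norm_add_le _ _).trans ?_
  rw [norm_mul, norm_mul _ (-((conj w - conj z) / (w - z)) * _), norm_mul, norm_mul, norm_pow,
    norm_pow, norm_pow, Complex.norm_real, Real.norm_of_nonneg hm]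
  calc _ ≤ m * ‖w - z‖ ^ 2 * max 0 (max C1 C2) + m ^ 2 * ‖w - z‖ ^ 4 * max 0 (max C1 C2) := by
        gcongr
        · exact h1.trans ((le_max_left _ _).trans (le_max_right _ _))
        · exact h2.trans ((le_max_right _ _).trans (le_max_right _ _))
    _ = _ := by ring

/-! ### The cut-off function -/

lemma cutoff_eventuallyEq_one {χ₀ : ℝ → ℝ} (hχ : IsCutoffProfile χ₀) {z₀ : ℂ} {r : ℝ} (hr : 0 < r)
    {w : ℂ} (hw : w ∈ ball z₀ (2 / 3 * r)) :
    (fun w => (cutoff χ₀ z₀ r w : ℂ)) =ᶠ[𝓝 w] fun _ => 1 := by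
  filter_upwards [isOpen_ball.mem_nhds hw] with x hx
  have hx' : ‖x - z₀‖ < 2 / 3 * r := by simpa [dist_eq_norm] using hx
  have h0 : 0 ≤ ‖x - z₀‖ / r := by positivity
  rw [cutoff, hχ.eq_one _ ⟨by linarith, by rwa [div_lt_iff₀ hr]⟩, Complex.ofReal_one]

lemma contDiff_cutoff {χ₀ : ℝ → ℝ} (hχ : IsCutoffProfile χ₀) (z₀ : ℂ) {r : ℝ} (hr : 0 < r) :
    ContDiff ℝ ((⊤ : ℕ∞) : WithTop ℕ∞) fun w => (cutoff χ₀ z₀ r w : ℂ) := by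
  rw [contDiff_iff_contDiffAt]
  intro w
  by_cases hw : w = z₀
  · refine contDiffAt_const.congr_of_eventuallyEq (cutoff_eventuallyEq_one hχ hr ?_)
    rw [hw]
    exact mem_ball_self (by positivity)
  · have h1 : ContDiffAt ℝ ((⊤ : ℕ∞) : WithTop ℕ∞) (fun w : ℂ => ‖w - z₀‖ / r) w :=
      ((contDiffAt_id.sub contDiffAt_const).norm ℝ (sub_ne_zero.2 hw)).div_const r
    exact Complex.ofRealCLM.contDiff.contDiffAt.comp w (hχ.smooth.contDiffAt.comp w h1)

/-- A compact subset of `(-1,1)` stays away from 1, so the cut-off lives in a closed disk inside the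
open one, where continuous functions are bounded. -/
lemma exists_cutoff_radius {χ₀ : ℝ → ℝ} (hχ : IsCutoffProfile χ₀) (z₀ : ℂ) {r : ℝ} (hr : 0 < r) :
    ∃ ρ : ℝ, 2 / 3 * r ≤ ρ ∧ ρ < r ∧
      ∀ w ∉ closedBall z₀ ρ, (cutoff χ₀ z₀ r w : ℂ) = 0 := by
  have hK : IsCompact (tsupport χ₀) := Metric.isCompact_of_isClosed_isBounded
    (isClosed_tsupport _) (isBounded_Ioo _ _ |>.subset hχ.supp)
  have hne : (tsupport χ₀).Nonempty :=
    ⟨0, subset_tsupport _ (by simp [hχ.eq_one 0 ⟨by norm_num, by norm_num⟩])⟩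
  obtain ⟨t, ht, hmax⟩ := hK.exists_isMaxOn hne continuousOn_id
  have ht1 : t < 1 := (hχ.supp ht).2
  refine ⟨max (2 / 3 * r) (t * r), le_max_left _ _, max_lt (by linarith) (by nlinarith),
    fun w hw => ?_⟩
  rw [mem_closedBall, dist_eq_norm, not_le, max_lt_iff] at hw
  suffices hmem : ‖w - z₀‖ / r ∉ tsupport χ₀ by
    rw [cutoff, image_eq_zero_of_notMem_tsupport hmem, Complex.ofReal_zero]
  intro hmem
  have : ‖w - z₀‖ / r ≤ t := hmax hmem
  rw [div_le_iff₀ hr] at this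
  linarith [hw.2]

/-! ### The representation formula -/

lemma SepHol.hasWirtBarAt_snd {F : ℂ → ℂ → ℂ} {c : ℂ} {r : ℝ}
    (h : SepHol F (ball c r) (ball (conj c) r)) {z w : ℂ} (hz : z ∈ ball c r)
    (hw : w ∈ ball c r) :
    HasWirtBarAt (fun w => F z (conj w)) (LocalBergman.D2 F z (conj w)) w := by
  have := HasWirtBarAt.comp (h.hasDerivAt_snd isOpen_ball hz (conj_mem_ball.2 hw))
    (HasWirtBarAt.conj_id w)
  rwa [mul_one] at this

/-- By the chain rule only the conjugated slot contributes, the first one being holomorphic in `w`.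
Applied to the polarization this computes `∂̄Q`. -/
lemma SepHol.hasWirtBarAt_diag {F : ℂ → ℂ → ℂ} {c : ℂ} {r : ℝ}
    (h : SepHol F (ball c r) (ball (conj c) r)) {w : ℂ} (hw : w ∈ ball c r) :
    HasWirtBarAt (fun w => F w (conj w)) (LocalBergman.D2 F w (conj w)) w := by
  have h1 := ((h.hasFDerivAt isOpen_ball isOpen_ball hw (conj_mem_ball.2 hw)).restrictScalars
    ℝ).comp w ((hasFDerivAt_id w).prodMk (hasFDerivAt_conj w))
  refine ⟨h1.differentiableAt, (wirtBar_of_hasFDerivAt h1).trans ?_⟩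
  simp
  linear_combination (LocalBergman.D1 F w (conj w) - LocalBergman.D2 F w (conj w)) / 2
    * Complex.I_mul_I

/-- The exponential factor `e^{m (P(z, w) - Q(w))}`. -/
def expPhase (Q : ℂ → ℝ) (P : ℂ → ℂ → ℂ) (m : ℝ) (z w : ℂ) : ℂ :=
  Complex.exp (m * (polar P z (conj w) - Q w))

/-- The part of the amplitude that comes from the derivatives of the cut-off function. -/
def cutoffAmp (X : ℂ → ℂ) (P : ℂ → ℂ → ℂ) (m : ℝ) (z w : ℂ) : ℂ :=
  -((2 * wirtBar X w + (conj w - conj z) * (wirtBar (wirtBar X) w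
      - 2 * m * phaseBar P z w * wirtBar X w))
    * (1 - logDerivB P z (conj z) * (w - z)) / (w - z))

/-- The smooth factor in the test function. -/
def testFactor (X : ℂ → ℂ) (Q : ℂ → ℝ) (P : ℂ → ℂ → ℂ) (m : ℝ) (z w : ℂ) : ℂ :=
  X w * ((1 - logDerivB P z (conj z) * (w - z)) * expPhase Q P m z w)

section

variable {Q : ℂ → ℝ} {P : ℂ → ℂ → ℂ} {z₀ : ℂ} {r : ℝ}

lemma IsAdmissible.hasWirtBarAt_Q (hQ : Continuous Q) (h : IsAdmissible Q P z₀ r) {w : ℂ}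
    (hw : w ∈ ball z₀ r) :
    HasWirtBarAt (fun w => (Q w : ℂ)) (D2 (polar P) w (conj w)) w := by
  refine ((h.sepHol hQ).hasWirtBarAt_diag hw).congr ?_
  filter_upwards [isOpen_ball.mem_nhds hw] with x hx
  rw [polar, Complex.conj_conj, h.polarization.diag x hx]

lemma IsAdmissible.hasWirtBarAt_expPhase (hQ : Continuous Q) (h : IsAdmissible Q P z₀ r) (m : ℝ)
    {z w : ℂ} (hz : z ∈ ball z₀ r) (hw : w ∈ ball z₀ r) :
    HasWirtBarAt (expPhase Q P m z) (-(m * phaseBar P z w * expPhase Q P m z w)) w := by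
  have h1 := (((h.sepHol hQ).hasWirtBarAt_snd hz hw).sub (h.hasWirtBarAt_Q hQ hw)).const_mul (m : ℂ)
  have h2 := HasWirtBarAt.comp (Complex.hasDerivAt_exp _) h1
  refine ⟨h2.1, h2.2.trans ?_⟩
  rw [phaseBar, expPhase]
  ring

lemma IsAdmissible.hasWirtBarAt_phaseBar (hQ : Continuous Q) (h : IsAdmissible Q P z₀ r)
    {z w : ℂ} (hz : z ∈ ball z₀ r) (hw : w ∈ ball z₀ r) :
    HasWirtBarAt (phaseBar P z) (phaseBar₁ P z w) w := by
  have hp := (h.sepHol hQ).D2 isOpen_ball isOpen_ball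
  exact (hp.hasWirtBarAt_diag hw).sub (hp.hasWirtBarAt_snd hz hw)

lemma hasWirtBarAt_linear (c z w : ℂ) : HasWirtBarAt (fun w => 1 - c * (w - z)) 0 w :=
  HasWirtBarAt.of_hasDerivAt
    ((((hasDerivAt_id w).sub_const z).const_mul c).const_sub 1)

lemma IsAdmissible.hasWirtBarAt_testFactor (hQ : Continuous Q) (h : IsAdmissible Q P z₀ r) (m : ℝ)
    {X : ℂ → ℂ} (hX : ContDiff ℝ ((⊤ : ℕ∞) : WithTop ℕ∞) X)
    {z w : ℂ} (hz : z ∈ ball z₀ r) (hw : w ∈ ball z₀ r) :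
    HasWirtBarAt (testFactor X Q P m z) ((wirtBar X w - m * (phaseBar P z w * X w))
      * ((1 - logDerivB P z (conj z) * (w - z)) * expPhase Q P m z w)) w := by
  have h1 := (HasWirtBarAt.of_contDiff hX w).mul
    ((hasWirtBarAt_linear (logDerivB P z (conj z)) z w).mul (h.hasWirtBarAt_expPhase hQ m hz hw))
  refine ⟨h1.1, h1.2.trans ?_⟩
  ring

lemma IsAdmissible.wirtBar_wirtBar_testFactor (hQ : Continuous Q) (h : IsAdmissible Q P z₀ r)
    (m : ℝ) {X : ℂ → ℂ} (hX : ContDiff ℝ ((⊤ : ℕ∞) : WithTop ℕ∞) X)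
    {z w : ℂ} (hz : z ∈ ball z₀ r) (hw : w ∈ ball z₀ r) :
    wirtBar (wirtBar (testFactor X Q P m z)) w
      = (wirtBar (wirtBar X) w - 2 * m * phaseBar P z w * wirtBar X w
        + ((m : ℂ) ^ 2 * phaseBar P z w ^ 2 - m * phaseBar₁ P z w) * X w)
      * ((1 - logDerivB P z (conj z) * (w - z)) * expPhase Q P m z w) := by
  have e : wirtBar (testFactor X Q P m z) =ᶠ[𝓝 w] fun w =>
      (wirtBar X w - m * (phaseBar P z w * X w))
      * ((1 - logDerivB P z (conj z) * (w - z)) * expPhase Q P m z w) := by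
    filter_upwards [isOpen_ball.mem_nhds hw] with x hx
    exact (h.hasWirtBarAt_testFactor hQ m hX hz hx).2
  have h1 := (((HasWirtBarAt.of_contDiff (contDiff_wirtBar hX) w).sub
    (((h.hasWirtBarAt_phaseBar hQ hz hw).mul (HasWirtBarAt.of_contDiff hX w)).const_mul
      (m : ℂ)))).mul
    ((hasWirtBarAt_linear (logDerivB P z (conj z)) z w).mul (h.hasWirtBarAt_expPhase hQ m hz hw))
  rw [wirtBar_congr e, h1.2]
  ring

lemma testFactor_eventuallyEq_zero {X : ℂ → ℂ} {m : ℝ} {z w : ℂ} (hw : w ∉ tsupport X) :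
    testFactor X Q P m z =ᶠ[𝓝 w] 0 := by
  filter_upwards [notMem_tsupport_iff_eventuallyEq.1 hw] with x hx
  simp [testFactor, hx]

lemma IsAdmissible.contDiff_testFactor (hQ : Continuous Q) (h : IsAdmissible Q P z₀ r)
    (m : ℝ) {X : ℂ → ℂ} (hX : ContDiff ℝ ((⊤ : ℕ∞) : WithTop ℕ∞) X)
    (hXs : tsupport X ⊆ ball z₀ r) {z : ℂ} (hz : z ∈ ball z₀ r) :
    ContDiff ℝ ((⊤ : ℕ∞) : WithTop ℕ∞) (testFactor X Q P m z) := by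
  rw [contDiff_iff_contDiffAt]
  intro w
  by_cases hw : w ∈ tsupport X
  · have hwB := hXs hw
    have hP : ContDiffAt ℝ ((⊤ : ℕ∞) : WithTop ℕ∞) (fun w => polar P z (conj w)) w :=
      (analyticAt_comp_conj ((h.sepHol hQ).snd z hz) hwB).contDiffAt
    have hQ' : ContDiffAt ℝ ((⊤ : ℕ∞) : WithTop ℕ∞) (fun w => (Q w : ℂ)) w :=
      Complex.ofRealCLM.contDiff.contDiffAt.comp w (h.analytic w hwB).contDiffAt
    exact hX.contDiffAt.mul ((contDiffAt_const.sub
      (contDiffAt_const.mul (contDiffAt_id.sub contDiffAt_const))).mul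
      (contDiffAt_const.mul (hP.sub hQ')).cexp)
  · exact contDiffAt_const.congr_of_eventuallyEq (testFactor_eventuallyEq_zero hw)

lemma hasCompactSupport_testFactor {X : ℂ → ℂ} (hX : HasCompactSupport X) {m : ℝ} {z : ℂ} :
    HasCompactSupport (testFactor X Q P m z) :=
  hX.mul_right

end

lemma integrable_bianalytic_representation {u G : ℂ → ℂ} (huc : Continuous u)
    (hG : ContDiff ℝ ((⊤ : ℕ∞) : WithTop ℕ∞) G) (hGc : HasCompactSupport G) {z : ℂ}
    (hz : wirtBar G z = 0) :
    Integrable (fun w => u w * (2 * wirtBar G w / (w - z)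
      + (conj w - conj z) / (w - z) * wirtBar (wirtBar G) w)) areaMeasure := by
  have hG1 := contDiff_wirtBar hG
  have hG2 := contDiff_wirtBar hG1
  obtain ⟨L, hL⟩ := hG1.lipschitzWith_of_hasCompactSupport (hasCompactSupport_wirtBar hGc) (by simp)
  have hL' : ∀ w, ‖wirtBar G w‖ ≤ L * ‖w - z‖ := fun w => by
    have := hL.dist_le_mul w z
    rwa [hz, dist_zero_right, dist_eq_norm] at this
  have hbound : Integrable
      ((tsupport G).indicator fun w => ‖u w‖ * (2 * L + ‖wirtBar (wirtBar G) w‖)) areaMeasure := by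
    rw [integrable_indicator_iff (isClosed_tsupport G).measurableSet]
    exact (huc.norm.mul (continuous_const.add hG2.continuous.norm)).continuousOn.integrableOn_compact
      hGc
  refine hbound.mono' ?_ (Eventually.of_forall fun w => ?_)
  · apply Measurable.aestronglyMeasurable
    have m1 := hG1.continuous.measurable
    have m2 := hG2.continuous.measurable
    have m3 := huc.measurable
    have m4 : Measurable fun w : ℂ => conj w := Complex.continuous_conj.measurable
    fun_prop
  · by_cases hw : w ∈ tsupport G
    · rw [indicator_of_mem hw, norm_mul]
      gcongr
      refine (norm_add_le _ _).trans (add_le_add ?_ ?_)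
      · rw [norm_div, norm_mul, Complex.norm_ofNat]
        refine div_le_of_le_mul₀ (norm_nonneg _) (by positivity) ?_
        linarith [hL' w]
      · rw [norm_mul, norm_div, norm_conj_sub]
        exact mul_le_of_le_one_left (norm_nonneg _) (div_self_le_one _)
    · have h1 : wirtBar G w = 0 :=
        image_eq_zero_of_notMem_tsupport fun h => hw (tsupport_wirtBar_subset G h)
      have h2 : wirtBar (wirtBar G) w = 0 := image_eq_zero_of_notMem_tsupport fun h =>
        hw (tsupport_wirtBar_subset G (tsupport_wirtBar_subset _ h))
      rw [indicator_of_notMem hw, h1, h2]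
      simp

/-! ### The error estimate -/

/-- From `1 + s + s²/2 ≤ e^s` with `s = at`. It trades polynomial growth in `t = m|w-z|²` for part
of the Gaussian decay. -/
lemma add_sq_le_exp {a t : ℝ} (ha : 0 < a) (ht : 0 ≤ t) :
    t + t ^ 2 ≤ (1 / a + 2 / a ^ 2) * Real.exp (a * t) := by
  have h0 : 0 ≤ a * t := by positivity
  have h1 := Real.quadratic_le_exp_of_nonneg h0
  have e : t + t ^ 2 = 1 / a * (a * t) + 2 / a ^ 2 * ((a * t) ^ 2 / 2) := by
    field_simp
  rw [e, add_mul]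
  gcongr
  · nlinarith [sq_nonneg (a * t)]
  · linarith

lemma integrable_gaussian {b : ℝ} (hb : 0 < b) (z : ℂ) :
    Integrable (fun w : ℂ => Real.exp (-b * ‖w - z‖ ^ 2)) areaMeasure := by
  have h := (GaussianFourier.integrable_cexp_neg_mul_sq_norm_add (V := ℂ) (b := (b : ℂ))
    (by simpa using hb) 0 0).norm
  have h2 : Integrable (fun w : ℂ => Real.exp (-b * ‖w‖ ^ 2)) volume := by
    refine h.congr (Eventually.of_forall fun w => ?_)
    simp [Complex.norm_exp, ← Complex.ofReal_pow]
  exact (h2.comp_sub_right z).smul_measure ENNReal.ofReal_ne_top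

lemma integral_gaussian {b : ℝ} (hb : 0 < b) (z : ℂ) :
    ∫ w : ℂ, Real.exp (-b * ‖w - z‖ ^ 2) ∂areaMeasure = 1 / b := by
  rw [areaMeasure, integral_smul_measure, integral_sub_right_eq_self
    (fun w : ℂ => Real.exp (-b * ‖w‖ ^ 2)) z, GaussianFourier.integral_rexp_neg_mul_sq_norm hb,
    Complex.finrank_real_complex, ENNReal.toReal_ofReal (by positivity)]
  have := Real.pi_ne_zero
  norm_num
  field_simp

/-- The Cauchy-Schwarz inequality against a Gaussian. -/
lemma integral_mul_gaussian_le {f : ℂ → ℝ} (hf : Continuous f) (hf0 : ∀ w, 0 ≤ f w)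
    (hi : Integrable (fun w => f w ^ 2) areaMeasure) {b : ℝ} (hb : 0 < b) (z : ℂ) :
    Integrable (fun w => f w * Real.exp (-b * ‖w - z‖ ^ 2)) areaMeasure ∧
    ∫ w, f w * Real.exp (-b * ‖w - z‖ ^ 2) ∂areaMeasure
      ≤ Real.sqrt (∫ w, f w ^ 2 ∂areaMeasure) * Real.sqrt (1 / (2 * b)) := by
  have hgc : Continuous fun w : ℂ => Real.exp (-b * ‖w - z‖ ^ 2) := by fun_prop
  have e : ∀ w : ℂ, Real.exp (-b * ‖w - z‖ ^ 2) ^ 2 = Real.exp (-(2 * b) * ‖w - z‖ ^ 2) := by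
    intro w
    rw [← Real.exp_nat_mul]
    congr 1
    push_cast
    ring
  have hfL : MemLp f 2 areaMeasure := (memLp_two_iff_integrable_sq hf.aestronglyMeasurable).2 hi
  have hgL : MemLp (fun w : ℂ => Real.exp (-b * ‖w - z‖ ^ 2)) 2 areaMeasure := by
    rw [memLp_two_iff_integrable_sq hgc.aestronglyMeasurable]
    simp_rw [e]
    exact integrable_gaussian (by positivity) z
  refine ⟨hfL.integrable_mul hgL, ?_⟩
  have h := integral_mul_le_Lp_mul_Lq_of_nonneg (μ := areaMeasure) Real.HolderConjugate.two_two
    (Eventually.of_forall hf0) (Eventually.of_forall fun w : ℂ => (Real.exp_pos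
      (-b * ‖w - z‖ ^ 2)).le) (by simpa using hfL) (by simpa using hgL)
  simp only [Real.rpow_two, e] at h
  rwa [integral_gaussian (by positivity), ← Real.sqrt_eq_rpow, ← Real.sqrt_eq_rpow] at h

section

variable {Q : ℂ → ℝ} {P : ℂ → ℂ → ℂ} {z₀ : ℂ} {r : ℝ}

/-- Half of the decay hypothesis, times `m`: `Re P - Q(w) = (Q(z)-Q(w))/2 + (2 Re P - Q(w) -
Q(z))/2`. -/
lemma IsAdmissible.norm_expPhase_le (h : IsAdmissible Q P z₀ r) {m : ℝ} (hm : 0 ≤ m)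
    {z w : ℂ} (hz : z ∈ ball z₀ r) (hw : w ∈ ball z₀ r) :
    ‖expPhase Q P m z w‖ ≤ Real.exp (m * Q z / 2) * Real.exp (-(m * Q w) / 2)
      * Real.exp (-(lapl Q z₀ / 4) * (m * ‖w - z‖ ^ 2)) := by
  have h1 := h.decay z hz w hw
  rw [expPhase, polar, Complex.conj_conj, Complex.norm_exp, ← Real.exp_add, ← Real.exp_add]
  apply Real.exp_le_exp.2
  rw [Complex.re_ofReal_mul, Complex.sub_re, Complex.ofReal_re]
  nlinarith

/-- The derivatives of `X` vanish on the disk of radius `2r/3` while `z` lies in that of radius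
`r/3`, so only `|w-z| ≥ r/3` matters. There `1 ≤ (3|w-z|/r)³`: one power pays for the denominator
`w-z`, two for the factor `|w-z|²`. -/
lemma IsAdmissible.cutoffAmp_bound (hQ : Continuous Q) (h : IsAdmissible Q P z₀ r) {ρ : ℝ}
    (hρ0 : 2 / 3 * r ≤ ρ) (hρ : ρ < r) {X : ℂ → ℂ} (hX : ContDiff ℝ ((⊤ : ℕ∞) : WithTop ℕ∞) X)
    (hX1 : ∀ w ∈ ball z₀ (2 / 3 * r), X =ᶠ[𝓝 w] fun _ => 1) :
    ∃ C : ℝ, 0 ≤ C ∧ ∀ m : ℝ, 1 ≤ m → ∀ z ∈ ball z₀ (r / 3), ∀ w ∈ closedBall z₀ ρ,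
      ‖cutoffAmp X P m z w‖ ≤ C * (m * ‖w - z‖ ^ 2) := by
  have hr := h.radius_pos
  have hH := h.sepHol hQ
  have hb := sepHol_bHol hH
  have hp := hH.D2 isOpen_ball isOpen_ball
  have hl : SepHol (logDerivB P) (ball z₀ r) (ball (conj z₀) r) :=
    (hb.D1 isOpen_ball isOpen_ball).div hb fun z hz v hv => h.bHol_ne hQ hz hv
  have hX1' := contDiff_wirtBar hX
  have hX2' := contDiff_wirtBar hX1'
  set S : Set (ℂ × ℂ) := closedBall z₀ ρ ×ˢ closedBall z₀ ρ
  have hS : IsCompact S := (isCompact_closedBall z₀ ρ).prod (isCompact_closedBall z₀ ρ)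
  have m1 : ∀ p ∈ S, p.1 ∈ closedBall z₀ ρ := fun p hp => hp.1
  have m2 : ∀ p ∈ S, p.2 ∈ closedBall z₀ ρ := fun p hp => hp.2
  have B1 : BddOn S fun p => wirtBar X p.2 := BddOn.of_continuousOn hS
    (hX1'.continuous.comp continuous_snd).continuousOn
  have B2 : BddOn S fun p => wirtBar (wirtBar X) p.2 := BddOn.of_continuousOn hS
    (hX2'.continuous.comp continuous_snd).continuousOn
  have BW : BddOn S fun p => conj p.2 - conj p.1 := BddOn.of_continuousOn hS
    ((Complex.continuous_conj.comp continuous_snd).sub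
      (Complex.continuous_conj.comp continuous_fst)).continuousOn
  have Bζ : BddOn S fun p => p.2 - p.1 := BddOn.of_continuousOn hS
    (continuous_snd.sub continuous_fst).continuousOn
  have Bh := (BddOn.const S 1).sub ((hl.bddOn hρ m1 m1).mul Bζ)
  have Ba : BddOn S fun p => phaseBar P p.1 p.2 := (hp.bddOn hρ m2 m2).sub (hp.bddOn hρ m1 m2)
  obtain ⟨C1, hC1⟩ := (((BddOn.const S 2).mul B1).add (BW.mul B2)).mul Bh
  obtain ⟨C2, hC2⟩ := (BW.mul (((BddOn.const S 2).mul Ba).mul B1)).mul Bh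
  refine ⟨(max C1 0 + max C2 0) * (3 / r) ^ 3, by positivity, fun m hm z hz w hw => ?_⟩
  have hzρ : z ∈ closedBall z₀ ρ := by
    rw [mem_ball] at hz
    rw [mem_closedBall]
    linarith
  by_cases hw1 : w ∈ ball z₀ (2 / 3 * r)
  · have e1 : wirtBar X =ᶠ[𝓝 w] 0 := by
      filter_upwards [isOpen_ball.mem_nhds hw1] with x hx
      rw [wirtBar_congr (hX1 x hx), wirtBar_const, Pi.zero_apply]
    rw [cutoffAmp, wirtBar_eq_zero_of_eventuallyEq_zero e1, e1.self_of_nhds]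
    simp only [Pi.zero_apply, mul_zero, sub_zero, add_zero, zero_mul, zero_div, neg_zero, norm_zero]
    positivity
  · have hd : r / 3 ≤ ‖w - z‖ := by
      rw [mem_ball, not_lt] at hw1
      rw [mem_ball] at hz
      rw [← dist_eq_norm]
      linarith [dist_triangle w z z₀]
    have hd1 : 1 ≤ ‖w - z‖ * (3 / r) := by
      calc 1 = r / 3 * (3 / r) := by field_simp
        _ ≤ _ := by gcongr
    have hpos : 0 < ‖w - z‖ := by linarith [div_pos hr three_pos]
    have h1 := hC1 (z, w) ⟨hzρ, hw⟩
    have h2 := hC2 (z, w) ⟨hzρ, hw⟩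
    dsimp only at h1 h2
    set T1 := (2 * wirtBar X w + (conj w - conj z) * wirtBar (wirtBar X) w)
      * (1 - logDerivB P z (conj z) * (w - z))
    set T2 := (conj w - conj z) * (2 * phaseBar P z w * wirtBar X w)
      * (1 - logDerivB P z (conj z) * (w - z))
    have e : cutoffAmp X P m z w = -((T1 - m * T2) / (w - z)) := by
      rw [cutoffAmp]
      ring
    rw [e, norm_neg, norm_div, div_le_iff₀ hpos]
    have hT : ‖T1 - m * T2‖ ≤ max C1 0 + m * max C2 0 := by
      refine (norm_sub_le _ _).trans (add_le_add (h1.trans (le_max_left _ _)) ?_)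
      rw [norm_mul, Complex.norm_real, Real.norm_of_nonneg (by linarith)]
      gcongr
      exact h2.trans (le_max_left _ _)
    calc ‖T1 - m * T2‖ ≤ max C1 0 + m * max C2 0 := hT
      _ ≤ m * max C1 0 + m * max C2 0 := by
        gcongr
        exact le_mul_of_one_le_left (le_max_right _ _) hm
      _ = m * (max C1 0 + max C2 0) * 1 := by ring
      _ ≤ m * (max C1 0 + max C2 0) * (‖w - z‖ * (3 / r)) ^ 3 := by
        gcongr
        exact one_le_pow₀ hd1
      _ = _ := by ring

/-- The amplitude of the total error is controlled by powers of `m |w - z|²`. -/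
lemma IsAdmissible.error_amp_bound (hQ : Continuous Q) (h : IsAdmissible Q P z₀ r) {ρ : ℝ}
    (hρ0 : 2 / 3 * r ≤ ρ) (hρ : ρ < r) {X : ℂ → ℂ} (hX : ContDiff ℝ ((⊤ : ℕ∞) : WithTop ℕ∞) X)
    (hX1 : ∀ w ∈ ball z₀ (2 / 3 * r), X =ᶠ[𝓝 w] fun _ => 1) :
    ∃ C : ℝ, 0 ≤ C ∧ ∀ m : ℝ, 1 ≤ m → ∀ z ∈ ball z₀ (r / 3), ∀ w ∈ closedBall z₀ ρ, w ≠ z →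
      ‖X w * (phaseAmp P m z w - amp P m z (conj z) w (conj w)) + cutoffAmp X P m z w‖
        ≤ C * (m * ‖w - z‖ ^ 2 + (m * ‖w - z‖ ^ 2) ^ 2) := by
  have hr := h.radius_pos
  obtain ⟨C1, hC1, h1⟩ := h.amplitude_bound hQ hρ
  obtain ⟨C2, hC2, h2⟩ := h.cutoffAmp_bound hQ hρ0 hρ hX hX1
  obtain ⟨M, hM⟩ := (isCompact_closedBall z₀ ρ).exists_bound_of_continuousOn
    hX.continuous.continuousOn
  refine ⟨max M 0 * C1 + C2, by positivity, fun m hm z hz w hw hne => ?_⟩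
  have hzρ : z ∈ closedBall z₀ ρ := by
    rw [mem_ball] at hz
    rw [mem_closedBall]
    linarith
  have hm0 : 0 ≤ m := by linarith
  refine (norm_add_le _ _).trans ?_
  rw [add_mul, norm_mul, mul_assoc]
  refine add_le_add (mul_le_mul ((hM w hw).trans (le_max_left _ _)) (h1 m hm0 z hzρ w hw hne)
    (norm_nonneg _) (le_max_right _ _)) ((h2 m hm z hz w hw).trans ?_)
  gcongr
  exact le_add_of_nonneg_right (sq_nonneg _)

end

/-! ### The reproducing property -/

section

variable {Q : ℂ → ℝ} {P : ℂ → ℂ → ℂ} {z₀ : ℂ} {r : ℝ}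

lemma IsAdmissible.twoTermKernel_mul_exp (hQ : Continuous Q) (h : IsAdmissible Q P z₀ r) (m : ℝ)
    {z w : ℂ} (hz : z ∈ ball z₀ r) (hw : w ∈ ball z₀ r) :
    twoTermKernel P m z w * (Real.exp (-(m * Q w)) : ℂ)
      = amp P m z (conj z) w (conj w) * expPhase Q P m z w := by
  rw [twoTermKernel_eq (h.sepHol hQ) hz hw, expPhase, Complex.ofReal_exp, mul_assoc,
    ← Complex.exp_add]
  congr 2
  push_cast
  ring

/-- The integrand in the representation formula, up to the factor `u`. -/
lemma IsAdmissible.representation_integrand (hQ : Continuous Q) (h : IsAdmissible Q P z₀ r) (m : ℝ)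
    {X : ℂ → ℂ} (hX : ContDiff ℝ ((⊤ : ℕ∞) : WithTop ℕ∞) X)
    {z w : ℂ} (hz : z ∈ ball z₀ r) (hw : w ∈ ball z₀ r) :
    -(2 * wirtBar (testFactor X Q P m z) w / (w - z)
      + (conj w - conj z) / (w - z) * wirtBar (wirtBar (testFactor X Q P m z)) w)
    = (X w * phaseAmp P m z w + cutoffAmp X P m z w) * expPhase Q P m z w := by
  rw [(h.hasWirtBarAt_testFactor hQ m hX hz hw).2, h.wirtBar_wirtBar_testFactor hQ m hX hz hw,
    phaseAmp, cutoffAmp]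
  ring

lemma IsAdmissible.reproducing (hQ : Continuous Q) (h : IsAdmissible Q P z₀ r)
    {χ₀ : ℝ → ℝ} (hχ : IsCutoffProfile χ₀) :
    ∃ C : ℝ, ∀ m : ℝ, 1 ≤ m → ∀ u ∈ bergmanSpace 2 m Q, ∀ z ∈ ball z₀ (r / 3),
      ‖u z - ∫ w in ball z₀ r, u w * (cutoff χ₀ z₀ r w : ℂ) * twoTermKernel P m z w
          * (Real.exp (-(m * Q w)) : ℂ) ∂areaMeasure‖
        ≤ C * (weightedNorm m Q u * Real.exp (m * Q z / 2) * m ^ (-(1 / 2) : ℝ)) := by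
  have hr := h.radius_pos
  have hΛ := h.lapl_pos
  set X : ℂ → ℂ := fun w => (cutoff χ₀ z₀ r w : ℂ)
  have hX : ContDiff ℝ ((⊤ : ℕ∞) : WithTop ℕ∞) X := contDiff_cutoff hχ z₀ hr
  have hX1 : ∀ w ∈ ball z₀ (2 / 3 * r), X =ᶠ[𝓝 w] fun _ => 1 :=
    fun w hw => cutoff_eventuallyEq_one hχ hr hw
  obtain ⟨ρ, hρ0, hρ, hX0⟩ := exists_cutoff_radius hχ z₀ hr
  have hsub : closedBall z₀ ρ ⊆ ball z₀ r := closedBall_subset_ball hρ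
  have hXs : tsupport X ⊆ closedBall z₀ ρ := by
    refine closure_minimal (fun w hw => ?_) isClosed_closedBall
    by_contra hn
    exact hw (hX0 w hn)
  have hXc : HasCompactSupport X :=
    (isCompact_closedBall z₀ ρ).of_isClosed_subset (isClosed_tsupport _) hXs
  obtain ⟨C, hC, hbound⟩ := h.error_amp_bound hQ hρ0 hρ hX hX1
  -- Half of the Gaussian rate `ΔQ(z₀)/4`: the growth `e^{at}` absorbs the amplitude and the decay
  -- `e^{-at}` remains.
  set a := lapl Q z₀ / 8 with ha
  have ha0 : 0 < a := by positivity
  set D := C * (1 / a + 2 / a ^ 2) with hD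
  refine ⟨D * Real.sqrt (1 / (2 * a)), fun m hm u hu z hz => ?_⟩
  have hm0 : 0 < m := by linarith
  have hzB : z ∈ ball z₀ r := ball_subset_ball (by linarith) hz
  have hz23 : z ∈ ball z₀ (2 / 3 * r) := ball_subset_ball (by linarith) hz
  have huc : Continuous u := continuousOn_univ.1 hu.1.1
  set G := testFactor X Q P m z with hG
  have hGs : ContDiff ℝ ((⊤ : ℕ∞) : WithTop ℕ∞) G :=
    h.contDiff_testFactor hQ m hX (hXs.trans hsub) hzB
  have hGc : HasCompactSupport G := hasCompactSupport_testFactor hXc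
  have hGz : G z = 1 := by
    have hXz : X z = 1 := (hX1 z hz23).self_of_nhds
    rw [hG, testFactor, hXz, expPhase, polar, Complex.conj_conj, h.polarization.diag z hzB]
    simp
  -- `X` is constant near `z`, `phaseBar` vanishes on the diagonal, and the linear factor is
  -- holomorphic.
  have hGz' : wirtBar G z = 0 := by
    rw [hG, (h.hasWirtBarAt_testFactor hQ m hX hzB hzB).2, wirtBar_congr (hX1 z hz23),
      wirtBar_const, phaseBar]
    simp
  have hrep := bianalytic_representation hu.1 hGs hGc hGz'
  have hNint := integrable_bianalytic_representation huc hGs hGc hGz'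
  rw [hGz, mul_one, ← integral_neg] at hrep
  set f : ℂ → ℂ := fun w => u w * X w * twoTermKernel P m z w * (Real.exp (-(m * Q w)) : ℂ)
    with hf
  have hf0 : ∀ w ∉ closedBall z₀ ρ, f w = 0 := fun w hw => by
    have : X w = 0 := hX0 w hw
    simp [hf, this]
  have hfi : Integrable f areaMeasure := by
    refine IntegrableOn.integrable_of_forall_notMem_eq_zero (s := closedBall z₀ ρ) ?_ hf0
    refine ContinuousOn.integrableOn_compact (isCompact_closedBall z₀ ρ) ?_
    have hK : ContinuousOn (fun w => twoTermKernel P m z w) (closedBall z₀ ρ) :=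
      ((h.analytic_snd hQ m hzB).continuousOn).mono hsub
    have hE : Continuous fun w => (Real.exp (-(m * Q w)) : ℂ) := by fun_prop
    exact ((huc.mul hX.continuous).continuousOn.mul hK).mul hE.continuousOn
  have hset : ∫ w in ball z₀ r, f w ∂areaMeasure = ∫ w, f w ∂areaMeasure :=
    setIntegral_eq_integral_of_forall_compl_eq_zero fun w hw => hf0 w fun hc => hw (hsub hc)
  rw [hset, hrep, ← integral_sub hNint.fun_neg hfi]
  set F : ℂ → ℝ := fun w => ‖u w‖ * Real.exp (-(m * Q w) / 2) with hF
  have hFc : Continuous F := by fun_prop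
  have hF2 : ∀ w, F w ^ 2 = ‖u w‖ ^ 2 * Real.exp (-(m * Q w)) := fun w => by
    rw [hF, mul_pow, ← Real.exp_nat_mul]
    congr 2
    push_cast
    ring
  have hFi : Integrable (fun w => F w ^ 2) areaMeasure := by
    simp_rw [hF2]
    exact hu.2
  obtain ⟨hgi, hgle⟩ := integral_mul_gaussian_le hFc (fun w => by positivity) hFi
    (b := m * a) (by positivity) z
  have hpt : ∀ᵐ w ∂areaMeasure, ‖-(u w * (2 * wirtBar G w / (w - z)
      + (conj w - conj z) / (w - z) * wirtBar (wirtBar G) w)) - f w‖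
      ≤ D * Real.exp (m * Q z / 2) * (F w * Real.exp (-(m * a) * ‖w - z‖ ^ 2)) := by
    have hne : ∀ᵐ w ∂areaMeasure, w ≠ z := by
      rw [ae_iff]
      simp
    filter_upwards [hne] with w hw
    by_cases hwρ : w ∈ closedBall z₀ ρ
    · have hwB := hsub hwρ
      have e : -(u w * (2 * wirtBar G w / (w - z)
          + (conj w - conj z) / (w - z) * wirtBar (wirtBar G) w)) - f w
          = u w * (X w * (phaseAmp P m z w - amp P m z (conj z) w (conj w))
            + cutoffAmp X P m z w) * expPhase Q P m z w := by
        have e1 := h.representation_integrand hQ m hX hzB hwB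
        have e2 := h.twoTermKernel_mul_exp hQ m hzB hwB
        rw [hf]
        linear_combination u w * e1 - u w * X w * e2
      set t := m * ‖w - z‖ ^ 2 with ht
      have ht0 : 0 ≤ t := by positivity
      have hb1 := hbound m hm z hz w hwρ hw
      have hb2 := h.norm_expPhase_le hm0.le hzB hwB
      rw [e, norm_mul, norm_mul]
      calc _ ≤ ‖u w‖ * (C * ((1 / a + 2 / a ^ 2) * Real.exp (a * t)))
            * (Real.exp (m * Q z / 2) * Real.exp (-(m * Q w) / 2)
              * Real.exp (-(lapl Q z₀ / 4) * t)) := by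
            gcongr
            exact hb1.trans (mul_le_mul_of_nonneg_left (add_sq_le_exp ha0 ht0) hC)
        _ = D * Real.exp (m * Q z / 2) * (‖u w‖ * Real.exp (-(m * Q w) / 2)
              * (Real.exp (a * t) * Real.exp (-(lapl Q z₀ / 4) * t))) := by
            rw [hD]
            ring
        _ = _ := by
            rw [← Real.exp_add]
            congr 3
            rw [ha, ht]
            ring
    · have hwX : w ∉ tsupport X := fun hc => hwρ (hXs hc)
      have hwG : G =ᶠ[𝓝 w] 0 := testFactor_eventuallyEq_zero hwX
      have hwG' : w ∉ tsupport G := notMem_tsupport_iff_eventuallyEq.2 hwG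
      have h1 : wirtBar G w = 0 := wirtBar_eq_zero_of_eventuallyEq_zero hwG
      have h2 : wirtBar (wirtBar G) w = 0 := image_eq_zero_of_notMem_tsupport fun hc =>
        hwG' (tsupport_wirtBar_subset G (tsupport_wirtBar_subset _ hc))
      rw [hf0 w hwρ, h1, h2]
      simp only [mul_zero, zero_div, add_zero, neg_zero, sub_zero, norm_zero]
      positivity
  refine (norm_integral_le_of_norm_le (hgi.const_mul _) hpt).trans ?_
  rw [integral_const_mul]
  have hw : Real.sqrt (∫ w, F w ^ 2 ∂areaMeasure) = weightedNorm m Q u := by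
    rw [weightedNorm]
    simp_rw [hF2]
  -- The `L²` norm of the remaining Gaussian is the source of `m^{-1/2}`.
  have hs : Real.sqrt (1 / (2 * (m * a))) = Real.sqrt (1 / (2 * a)) * m ^ (-(1 / 2) : ℝ) := by
    rw [Real.rpow_neg hm0.le, ← Real.sqrt_eq_rpow, ← Real.sqrt_inv, ← Real.sqrt_mul (by positivity)]
    congr 1
    field_simp
  rw [hw, hs] at hgle
  calc _ ≤ D * Real.exp (m * Q z / 2)
        * (weightedNorm m Q u * (Real.sqrt (1 / (2 * a)) * m ^ (-(1 / 2) : ℝ))) := by gcongr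
    _ = _ := by ring

end

end LocalBergman

end

theorem mainTheorem7 (Q : ℂ → ℝ) (hQ : Continuous Q) (P : ℂ → ℂ → ℂ) (z₀ : ℂ) (r : ℝ)
    (hr : LocalBergman.IsAdmissible Q P z₀ r)
    (χ₀ : ℝ → ℝ) (hχ : LocalBergman.IsCutoffProfile χ₀) :
    LocalBergman.IsLocalBergmanKernel 2 Q z₀ r χ₀ (fun m => m ^ (-(1 / 2) : ℝ))
      (LocalBergman.twoTermKernel P) := by
  exact
    { polyanalytic_fst := fun m _ _ hw => hr.polyanalytic_fst hQ m hw
      analytic_snd := fun m _ _ hz => hr.analytic_snd hQ m hz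
      reproducing := hr.reproducing hQ hχ
      conjPolyanalytic_snd := fun m _ _ hz => hr.conjPolyanalytic_snd hQ m hz }
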